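/- A (scalar) $C^*$-probability space is a pair $(\mathcal A,\varphi)$ of a unital $C^*$-algebra $\mathcal A$ and a state $\varphi$ on $\mathcal A$ (not required to be faithful). For $Y=Y^*\in\mathcal A$, let $\mu_Y$ be its distribution, i.e. the Borel probability measure on $\mathbb R$ with $\int f\,d\mu_Y=\varphi(f(Y))$ for all $f\in C_c(\mathbb R)$. Elements $y_1,\dots,y_n\in\mathcal A$ are monotone independent if, for all $m\ge 1$, all $i_1,\dots,i_m\in\{1,\dots,n\}$ and all $a_k$ in the non-unital subalgebra of $\mathcal A$ generated by $y_{i_k}$, $$\varphi(a_1\cdots a_m)=\varphi(a_j)\,\varphi(a_1\cdots a_{j-1}a_{j+1}\cdots a_m)$$ whenever $i_{j-1}<i_j>i_{j+1}$ (an inequality about a missing neighbour is dropped). A self-adjoint $Y\in\mathcal A$ is called monotone infinitely divisible if for every $n\ge1$ it has the same moments as a sum $y_1+\dots+y_n$ of identically distributed, monotone independent self-adjoint elements of some $C^*$-probability space (which may depend on $n$). A standard arcsine element is a self-adjoint element $A$ of a $C^*$-probability space whose distribution $\mu_A$ is the arcsine law with density $\frac{1}{\pi\sqrt{2-t^2}}$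 on $(-\sqrt2,\sqrt2)$, which has mean $0$ and variance $1$. The L\'evy distance of Borel probability measures $\mu,\nu$ on $\mathbb R$ with distribution functions $\mathcal F_\mu,\mathcal F_\nu$ is $$L(\mu,\nu)=\inf\{\epsilon>0:\ \mathcal F_\mu(t-\epsilon)-\epsilon\le\mathcal F_\nu(t)\le\mathcal F_\mu(t+\epsilon)+\epsilon\ \text{ for all } t\in\mathbb R\}.$$ **Theorem (scalar monotone fourth moment theorem).** There is a universal constant $K>0$ such that for every $C^*$-probability space $(\mathcal A,\varphi)$, every monotone infinitely divisible self-adjoint $Y\in\mathcal A$ with $\varphi(Y)=0$ and $\varphi(Y^2)=1$, and every standard arcsine element $A$ (of any $C^*$-probability space), one has $\varphi(Y^4)\ge\frac32$ and $$L(\mu_Y,\mu_A)\le K\Big(\varphi(Y^4)-\frac32\Big)^{1/14}.$$ -/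

import Mathlib

open MeasureTheory
open scoped ComplexOrder CompactlySupported

noncomputable section

namespace MonotoneProbability

/-- A state on a unital C*-algebra: a positive linear functional `φ` with `φ 1 = 1`.
A unital C*-algebra with a state is a scalar-valued C*-probability space. (Faithfulness is not
required.) -/
structure CState (A : Type*) [CStarAlgebra A] extends A →ₗ[ℂ] ℂ where
  map_one' : toFun 1 = 1
  nonneg' : ∀ a : A, 0 ≤ toFun (star a * a)

instance {A : Type*} [CStarAlgebra A] : CoeFun (CState A) (fun _ => A → ℂ) :=
  ⟨fun φ => φ.toLinearMap⟩

theorem CState.cfc_nonneg {A : Type*} [CStarAlgebra A] (φ : CState A) (a : A)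
    (f : ℝ → ℝ) (hf : Continuous f) (h0 : ∀ t, 0 ≤ f t) : 0 ≤ φ (cfc f a) := by
  have h1 : cfc f a = star (cfc (fun t => Real.sqrt (f t)) a) *
      cfc (fun t => Real.sqrt (f t)) a := by
    rw [(cfc_predicate (R := ℝ) (fun t => Real.sqrt (f t)) a : IsSelfAdjoint _).star_eq,
      ← cfc_mul (fun t => Real.sqrt (f t)) (fun t => Real.sqrt (f t)) a
        (hf.sqrt.continuousOn) (hf.sqrt.continuousOn)]
    congr 1
    funext t
    exact (Real.mul_self_sqrt (h0 t)).symm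
  rw [h1]
  exact φ.nonneg' _

/-- The positive linear functional `f ↦ φ (f(a))` on compactly supported continuous functions on
the line, where `f(a)` is given by the continuous functional calculus. -/
def CState.functional {A : Type*} [CStarAlgebra A] (φ : CState A) (a : A) :
    C_c(ℝ, ℝ) →ₚ[ℝ] ℝ :=
  PositiveLinearMap.mk₀
    { toFun := fun f => (φ (cfc (fun t => f t) a)).re
      map_add' := fun f g => by
        have h : cfc (fun t => (f + g) t) a = cfc (fun t => f t) a + cfc (fun t => g t) a :=
          cfc_add (a := a) (fun t => f t) (fun t => g t)
            f.continuous.continuousOn g.continuous.continuousOn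
        rw [h, map_add, Complex.add_re]
      map_smul' := fun r f => by
        have h : cfc (fun t => (r • f) t) a = r • cfc (fun t => f t) a :=
          cfc_smul r (fun t => f t) a f.continuous.continuousOn
        have h2 : φ (r • cfc (fun t => f t) a) = (r : ℂ) * φ (cfc (fun t => f t) a) := by
          rw [← Complex.coe_smul, map_smul, smul_eq_mul]
        rw [h, h2, Complex.re_ofReal_mul, RingHom.id_apply, smul_eq_mul] }
    (fun f hf => (Complex.nonneg_iff.1 (φ.cfc_nonneg a (fun t => f t) f.continuous hf)).1)

/-- The (analytic) distribution `μ_a` of a self-adjoint element `a` of `(A, φ)`: the Borel measure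
on the line with `∫ f dμ_a = φ (f(a))` for every `f ∈ C_c(ℝ)`. -/
def CState.distribution {A : Type*} [CStarAlgebra A] (φ : CState A) (a : A) : Measure ℝ :=
  RealRMK.rieszMeasure (φ.functional a)

/-- Two (self-adjoint) elements of possibly different C*-probability spaces are identically
distributed: they have the same moments. -/
def SameMoments {A B : Type*} [CStarAlgebra A] [CStarAlgebra B]
    (φ : CState A) (a : A) (ψ : CState B) (b : B) : Prop :=
  ∀ k : ℕ, φ (a ^ k) = ψ (b ^ k)

/-- Monotone independence of a linearly ordered family of (not necessarily unital) subalgebras: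
`φ (x₁ ⋯ x_j ⋯ xₙ) = φ (x_j) φ (x₁ ⋯ x_{j-1} x_{j+1} ⋯ xₙ)` whenever `x_k ∈ S (i_k)` and
`i_{j-1} < i_j > i_{j+1}`, where an inequality about a missing neighbour is dropped. The word is
written as `l`, then `x_j = x` with label `i_j = i`, then `r`; the letters of `l` and `r` are
stored together with their labels. -/
def MonotoneIndependent {A : Type*} [CStarAlgebra A] (φ : CState A) {ι : Type*} [LinearOrder ι]
    (S : ι → NonUnitalSubalgebra ℂ A) : Prop :=
  ∀ (l r : List (ι × A)) (i : ι) (x : A),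
    (∀ p ∈ l, p.2 ∈ S p.1) → (∀ p ∈ r, p.2 ∈ S p.1) → x ∈ S i →
    (∀ p ∈ l.getLast?, p.1 < i) → (∀ p ∈ r.head?, p.1 < i) →
    φ ((l.map Prod.snd).prod * x * (r.map Prod.snd).prod) =
      φ x * φ ((l.map Prod.snd).prod * (r.map Prod.snd).prod)

/-- Monotone independence of elements: that of the non-unital algebras they generate. -/
def MonotoneIndependentElements {A : Type*} [CStarAlgebra A] (φ : CState A)
    {ι : Type*} [LinearOrder ι] (y : ι → A) : Prop :=
  MonotoneIndependent φ (fun i => NonUnitalAlgebra.adjoin ℂ {y i})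

/-- `Y` is monotone infinitely divisible: for every `n ≥ 1`, it has the distribution of a sum
`y₁ + ⋯ + yₙ` of identically distributed, monotone independent self-adjoint elements of some
C*-probability space (which may depend on `n`). -/
def IsMonotoneInfinitelyDivisible.{u, v} {A : Type u} [CStarAlgebra A] (φ : CState A) (Y : A) :
    Prop :=
  ∀ n : ℕ, 1 ≤ n → ∃ (B : Type v) (_ : CStarAlgebra B) (ψ : CState B) (y : Fin n → B),
    (∀ i, IsSelfAdjoint (y i)) ∧
    (∀ i j, SameMoments ψ (y i) ψ (y j)) ∧
    MonotoneIndependentElements ψ y ∧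
    SameMoments φ Y ψ (∑ i, y i)

/-- The standard arcsine law (mean `0`, variance `1`), with density `1 / (π √(2 - t²))` on
`(-√2, √2)`. -/
def arcsineLaw : Measure ℝ :=
  (volume.restrict (Set.Ioo (-Real.sqrt 2) (Real.sqrt 2))).withDensity
    (fun t => ENNReal.ofReal (1 / (Real.pi * Real.sqrt (2 - t ^ 2))))

/-- A standard arcsine element: a self-adjoint element whose distribution is the standard arcsine
law. -/
def IsStandardArcsine {A : Type*} [CStarAlgebra A] (φ : CState A) (a : A) : Prop :=
  IsSelfAdjoint a ∧ φ.distribution a = arcsineLaw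

/-- The Lévy distance of two Borel probability measures on the line; `μ.real (Set.Iic t)` is the
distribution function of `μ` at `t`. -/
def levyDist (μ ν : Measure ℝ) : ℝ :=
  sInf {ε : ℝ | 0 < ε ∧ ∀ t : ℝ,
    μ.real (Set.Iic (t - ε)) - ε ≤ ν.real (Set.Iic t) ∧
    ν.real (Set.Iic t) ≤ μ.real (Set.Iic (t + ε)) + ε}

end MonotoneProbability

end

universe u v w

/-! Write `F` for the reciprocal Cauchy transform. Monotone independence turns addition into
composition of these transforms (`recipCauchy_add`), so for a monotone infinitely divisible `Y` the
function `F_Y` is the `n`-fold iterate of a single map `f`, the transform of a centred summand of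
variance `1/n`. For the arcsine law, `F(z)² = z² - 2`.

The estimate `recipCauchy_bounds` says that `w (w - f w)` equals the variance `1/n` up to an error
governed by `m₄ - m₂²`, the variance of the square of the summand. Hence one application of `f`
lowers `w²` by about `2/n`, and `n` applications give `F_Y(z)² ≈ z² - 2` (`iterate_sq_sub_le`). The
moment recursion gives `n (m₄ - m₂²) = φ(Y⁴) - 3/2 + 1/(2n)`. Its left side is nonnegative, so `n →
∞` yields both `φ(Y⁴) ≥ 3/2` and `|F_Y(z)² - (z² - 2)| ≤ 2 √δ / Im z` with `δ = φ(Y⁴) - 3/2`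
(`recipCauchy_sq_sub`).

The rest is Stieltjes inversion at height `η`. Passing from squares to reciprocals costs `η⁻³`, so
the Cauchy transforms differ by at most `√δ η⁻³ / |F|`, where `1/|F|` has a majorant integrable in
`t` and independent of `η`. Removing the Poisson smoothing at scale `ε = √η` costs `η/ε = √η`. The
two errors balance at `η = δ^(1/7)`, which produces the exponent `1/14`. -/

noncomputable section

namespace MonotoneProbability

open Complex

/-! ### States: reality, Cauchy-Schwarz, continuity. -/

section State

variable {A : Type*} [CStarAlgebra A] (φ : CState A)

theorem CState.apply_one : φ 1 = 1 := φ.map_one'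

theorem CState.nonneg (a : A) : 0 ≤ φ (star a * a) := φ.nonneg' a

theorem CState.apply_algebraMap (z : ℂ) : φ (algebraMap ℂ A z) = z := by
  rw [Algebra.algebraMap_eq_smul_one, map_smul, φ.apply_one, smul_eq_mul, mul_one]

/-- Polarization: `4a = (a + 1)² - (a - 1)²` is a difference of positive elements. -/
theorem CState.im_apply_of_isSelfAdjoint {a : A} (ha : IsSelfAdjoint a) : (φ a).im = 0 := by
  have key : φ ((4 : ℂ) • a) = φ (star (a + 1) * (a + 1)) - φ (star (a - 1) * (a - 1)) := by
    rw [← map_sub]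
    congr 1
    simp only [star_add, star_sub, star_one, ha.star_eq]
    rw [show (4 : ℂ) • a = a + a + a + a by module]
    noncomm_ring
  have h1 := (Complex.nonneg_iff.1 (φ.nonneg (a + 1))).2
  have h2 := (Complex.nonneg_iff.1 (φ.nonneg (a - 1))).2
  have h3 := congrArg Complex.im key
  rw [map_smul, smul_eq_mul, Complex.sub_im, ← h1, ← h2] at h3
  simpa using h3

theorem CState.apply_star (a : A) : φ (star a) = (starRingEnd ℂ) (φ a) := by
  have h1 := φ.im_apply_of_isSelfAdjoint (IsSelfAdjoint.add_star_self a)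
  have h2 := φ.im_apply_of_isSelfAdjoint (a := I • (a - star a)) (by
    rw [IsSelfAdjoint, star_smul, star_sub, star_star]
    simp only [RCLike.star_def, Complex.conj_I, neg_smul, ← smul_neg, neg_sub])
  rw [map_add, Complex.add_im] at h1
  rw [map_smul, smul_eq_mul, map_sub] at h2
  simp only [Complex.mul_im, Complex.I_re, Complex.I_im, Complex.sub_re] at h2
  apply Complex.ext
  · rw [Complex.conj_re]; linarith
  · rw [Complex.conj_im]; linarith

/-- The Cauchy-Schwarz inequality for a state. -/
theorem CState.norm_apply_star_mul_sq_le (a b : A) :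
    ‖φ (star a * b)‖ ^ 2 ≤ (φ (star a * a)).re * (φ (star b * b)).re := by
  let c : PreInnerProductSpace.Core ℂ A :=
    { inner := fun x y => φ (star x * y)
      conj_inner_symm := fun x y => by
        rw [← φ.apply_star, star_mul, star_star]
      re_inner_nonneg := fun x => (Complex.nonneg_iff.1 (φ.nonneg x)).1
      add_left := fun x y z => by rw [star_add, add_mul, map_add]
      smul_left := fun x y r => by
        rw [star_smul, smul_mul_assoc, map_smul]; rfl }
  have h := @InnerProductSpace.Core.inner_mul_inner_self_le ℂ A _ _ _ c a b
  have h2 : ‖φ (star b * a)‖ = ‖φ (star a * b)‖ := by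
    rw [← RCLike.norm_conj (φ (star a * b)), ← φ.apply_star, star_mul, star_star]
  change ‖φ (star a * b)‖ * ‖φ (star b * a)‖ ≤ (φ (star a * a)).re * (φ (star b * b)).re at h
  rwa [h2, ← sq] at h

theorem CState.re_apply_star_mul_self_nonneg (a : A) : 0 ≤ (φ (star a * a)).re :=
  (Complex.nonneg_iff.1 (φ.nonneg a)).1

theorem CState.re_apply_star_mul_self_le (a : A) : (φ (star a * a)).re ≤ ‖a‖ ^ 2 := by
  have hsa : IsSelfAdjoint (star a * a) := IsSelfAdjoint.star_mul_self a
  -- Positivity of `‖a‖² - a* a`. The truncation by `0` makes the function nonnegative on the whole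
  -- line, as `cfc_nonneg` demands, and changes nothing on the spectrum.
  have h0 := φ.cfc_nonneg (star a * a) (fun t => max 0 (‖a‖ ^ 2 - t)) (by fun_prop)
    (fun t => le_max_left _ _)
  have h1 : cfc (fun t : ℝ => max 0 (‖a‖ ^ 2 - t)) (star a * a)
      = algebraMap ℝ A (‖a‖ ^ 2) - star a * a := by
    rw [cfc_congr (g := fun t : ℝ => ‖a‖ ^ 2 - t), cfc_sub _ _ _ (by fun_prop) (by fun_prop),
      cfc_const _ _ hsa, cfc_id' ℝ _ hsa]
    intro t ht
    refine max_eq_right (sub_nonneg.2 ?_)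
    have h2 : ‖t‖ ≤ ‖star a * a‖ * ‖(1 : A)‖ := spectrum.norm_le_norm_mul_of_mem ht
    have h3 : ‖(1 : A)‖ ≤ 1 := by
      rcases subsingleton_or_nontrivial A with h | h
      · rw [Subsingleton.elim (1 : A) 0, norm_zero]; exact zero_le_one
      · exact (CStarRing.norm_one (E := A)).le
    rw [CStarRing.norm_star_mul_self, ← sq] at h2
    calc t ≤ ‖t‖ := Real.le_norm_self t
      _ ≤ ‖a‖ ^ 2 * ‖(1 : A)‖ := h2
      _ ≤ ‖a‖ ^ 2 := mul_le_of_le_one_right (sq_nonneg _) h3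
  rw [h1, map_sub, IsScalarTower.algebraMap_apply ℝ ℂ A, φ.apply_algebraMap] at h0
  have h4 := (Complex.nonneg_iff.1 h0).1
  rw [Complex.sub_re, Complex.coe_algebraMap, Complex.ofReal_re] at h4
  exact sub_nonneg.1 h4

theorem CState.norm_apply_le (a : A) : ‖φ a‖ ≤ ‖a‖ := by
  have h := φ.norm_apply_star_mul_sq_le 1 a
  rw [star_one, one_mul, one_mul, φ.apply_one, Complex.one_re, one_mul] at h
  exact (sq_le_sq₀ (norm_nonneg _) (norm_nonneg _)).1 (h.trans (φ.re_apply_star_mul_self_le a))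

theorem CState.continuous : Continuous (φ : A → ℂ) :=
  (φ.toLinearMap.mkContinuous 1 (fun a => by simpa using φ.norm_apply_le a)).continuous

end State

/-! ### Resolvents of self-adjoint elements off the real line. -/

section Resolvent

variable {A : Type*} [CStarAlgebra A] {a : A} {z : ℂ}

theorem isUnit_algebraMap_sub (ha : IsSelfAdjoint a) (hz : z.im ≠ 0) :
    IsUnit (algebraMap ℂ A z - a) := by
  by_contra h
  exact hz (by rw [ha.mem_spectrum_eq_re (spectrum.mem_iff.2 h), Complex.ofReal_im])

theorem mul_resolvent (ha : IsSelfAdjoint a) (hz : z.im ≠ 0) :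
    (algebraMap ℂ A z - a) * resolvent a z = 1 :=
  Ring.mul_inverse_cancel _ (isUnit_algebraMap_sub ha hz)

theorem resolvent_mul (ha : IsSelfAdjoint a) (hz : z.im ≠ 0) :
    resolvent a z * (algebraMap ℂ A z - a) = 1 :=
  Ring.inverse_mul_cancel _ (isUnit_algebraMap_sub ha hz)

theorem resolvent_eq_of_mul_eq_one (ha : IsSelfAdjoint a) (hz : z.im ≠ 0) {b : A}
    (hb : (algebraMap ℂ A z - a) * b = 1) : resolvent a z = b := by
  rw [← mul_one (resolvent a z), ← hb, ← mul_assoc, resolvent_mul ha hz, one_mul]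

theorem star_resolvent (ha : IsSelfAdjoint a) (hz : z.im ≠ 0) :
    star (resolvent a z) * (algebraMap ℂ A ((starRingEnd ℂ) z) - a) = 1 := by
  have h := congrArg star (mul_resolvent ha hz)
  rwa [star_mul, star_sub, ha.star_eq, star_one, ← algebraMap_star_comm] at h

/-- By spectral permanence the inverse stays in the C*-algebra generated by `a`, where polynomials
in `a` are dense. This lets identities for powers of `a` pass to its resolvent by continuity. -/
theorem resolvent_mem_closure_adjoin (ha : IsSelfAdjoint a) (hz : z.im ≠ 0) :
    resolvent a z ∈ closure (Algebra.adjoin ℂ {a} : Set A) := by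
  have hcl : (StarAlgebra.elemental ℂ a : Set A) = closure (Algebra.adjoin ℂ {a} : Set A) := by
    rw [StarAlgebra.elemental, StarSubalgebra.topologicalClosure_coe]
    congr 1
    rw [← StarSubalgebra.coe_toSubalgebra, StarAlgebra.adjoin_toSubalgebra, Set.star_singleton,
      ha.star_eq, Set.union_self]
  rw [← hcl]
  have hmem : algebraMap ℂ A z - a ∈ StarAlgebra.elemental ℂ a :=
    sub_mem (algebraMap_mem _ z) (StarAlgebra.elemental.self_mem ℂ a)
  have : IsClosed (StarAlgebra.elemental ℂ a : Set A) := StarAlgebra.elemental.isClosed ℂ a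
  have hu := (StarSubalgebra.coe_isUnit (S := StarAlgebra.elemental ℂ a) (a := ⟨_, hmem⟩)).1
    (isUnit_algebraMap_sub ha hz)
  obtain ⟨b, hb⟩ := hu.exists_right_inv
  have hb' := congrArg Subtype.val hb
  rw [resolvent_eq_of_mul_eq_one ha hz hb']
  exact b.2

end Resolvent

/-- The Cauchy transform of the distribution of `a`, namely `z ↦ φ ((z - a)⁻¹)`. -/
def CState.cauchy {A : Type*} [CStarAlgebra A] (φ : CState A) (a : A) (z : ℂ) : ℂ :=
  φ (resolvent a z)

/-- The reciprocal Cauchy transform. -/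
def CState.recipCauchy {A : Type*} [CStarAlgebra A] (φ : CState A) (a : A) (z : ℂ) : ℂ :=
  (φ.cauchy a z)⁻¹

/-- Working with the pair `(a, b)` in the product algebra, the same polynomials approximate both
resolvents at once. -/
theorem SameMoments.cauchy_eq {A B : Type*} [CStarAlgebra A] [CStarAlgebra B]
    {φ : CState A} {a : A} {ψ : CState B} {b : B} (h : SameMoments φ a ψ b)
    (ha : IsSelfAdjoint a) (hb : IsSelfAdjoint b) {z : ℂ} (hz : z.im ≠ 0) :
    φ.cauchy a z = ψ.cauchy b z := by
  have hab : IsSelfAdjoint ((a, b) : A × B) := Prod.ext ha hb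
  have hmem := resolvent_mem_closure_adjoin hab hz
  have hm := mul_resolvent hab hz
  have h1 : resolvent a z = (resolvent ((a, b) : A × B) z).1 :=
    resolvent_eq_of_mul_eq_one ha hz (congrArg Prod.fst hm)
  have h2 : resolvent b z = (resolvent ((a, b) : A × B) z).2 :=
    resolvent_eq_of_mul_eq_one hb hz (congrArg Prod.snd hm)
  rw [CState.cauchy, CState.cauchy, h1, h2]
  have hc : IsClosed {p : A × B | φ p.1 = ψ p.2} :=
    isClosed_eq (φ.continuous.comp continuous_fst) (ψ.continuous.comp continuous_snd)
  refine closure_minimal ?_ hc hmem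
  intro p hp
  obtain ⟨q, rfl⟩ := (Algebra.adjoin_singleton_eq_range_aeval ℂ ((a, b) : A × B) ▸ hp :
    p ∈ (Polynomial.aeval ((a, b) : A × B)).range)
  change φ _ = ψ _
  clear hp
  induction q using Polynomial.induction_on' with
  | add p q hp hq =>
    simp only [map_add, Prod.fst_add, Prod.snd_add] at hp hq ⊢
    rw [hp, hq]
  | monomial n c =>
    rw [AlgHom.toRingHom_eq_coe, RingHom.coe_coe, Polynomial.aeval_monomial, ← Algebra.smul_def,
      Prod.smul_fst, Prod.smul_snd, Prod.pow_fst, Prod.pow_snd, map_smul, map_smul, h n]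

/-! ### The reciprocal Cauchy transform of one element. -/

section OneVariable

variable {A : Type*} [CStarAlgebra A] {φ : CState A} {a : A} {w : ℂ}

/-- Apply the state to the resolvent identity `R* - R = (w - w̄) R* R`. -/
theorem CState.im_cauchy_eq (φ : CState A) (ha : IsSelfAdjoint a) (hw : 0 < w.im) :
    (φ.cauchy a w).im = -(w.im * (φ (star (resolvent a w) * resolvent a w)).re) := by
  set R := resolvent a w with hR
  have h1 : (algebraMap ℂ A w - a) * R = 1 := mul_resolvent ha hw.ne'
  have h2 : star R * (algebraMap ℂ A ((starRingEnd ℂ) w) - a) = 1 := star_resolvent ha hw.ne'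
  have h3 : star R - R = (w - (starRingEnd ℂ) w) • (star R * R) := by
    calc star R - R = star R * ((algebraMap ℂ A w - a) * R)
          - (star R * (algebraMap ℂ A ((starRingEnd ℂ) w) - a)) * R := by
            rw [h1, h2, mul_one, one_mul]
      _ = star R * (algebraMap ℂ A (w - (starRingEnd ℂ) w)) * R := by
            rw [map_sub]; noncomm_ring
      _ = _ := by
            rw [← Algebra.commutes, Algebra.smul_def, mul_assoc]
  have h4 := congrArg (fun x => (φ x).im) h3
  have h0 := Complex.nonneg_iff.1 (φ.nonneg R)
  simp only [map_sub, map_smul, smul_eq_mul, φ.apply_star, Complex.sub_im, Complex.conj_im,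
    Complex.mul_im, Complex.sub_re, Complex.conj_re, ← h0.2] at h4
  change (φ R).im = _
  linarith

theorem CState.im_cauchy_neg (φ : CState A) (ha : IsSelfAdjoint a) (hw : 0 < w.im) :
    (φ.cauchy a w).im < 0 := by
  rw [φ.im_cauchy_eq ha hw, neg_lt_zero]
  refine mul_pos hw (lt_of_le_of_ne (φ.re_apply_star_mul_self_nonneg _) fun h => ?_)
  -- Cauchy-Schwarz applied to `(w - a) R = 1` bounds `1` by a multiple of `φ(R* R)`, which
  -- therefore cannot vanish.
  have h5 := φ.norm_apply_star_mul_sq_le (star (algebraMap ℂ A w - a)) (resolvent a w)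
  rw [star_star, mul_resolvent ha hw.ne', φ.apply_one, norm_one, ← h] at h5
  norm_num at h5

theorem CState.cauchy_ne_zero (φ : CState A) (ha : IsSelfAdjoint a) (hw : 0 < w.im) :
    φ.cauchy a w ≠ 0 := by
  intro h
  have := φ.im_cauchy_neg ha hw
  rw [h] at this
  exact lt_irrefl _ this

/-- The variance of `a`, when its mean is zero, controls the reciprocal Cauchy transform. -/
theorem CState.recipCauchy_bounds (φ : CState A) (ha : IsSelfAdjoint a) (h0 : φ a = 0)
    (hw : 0 < w.im) :
    w.im ≤ (φ.recipCauchy a w).im ∧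
    ‖w - φ.recipCauchy a w‖ ≤ (φ (a ^ 2)).re / w.im ∧
    ‖w * (w - φ.recipCauchy a w) - φ (a ^ 2)‖ ≤
      Real.sqrt ((φ (a ^ 4)).re - (φ (a ^ 2)).re ^ 2) * Real.sqrt (φ (a ^ 2)).re / w.im := by
  have hG := φ.cauchy_ne_zero ha hw
  set R := resolvent a w with hR
  set g := w - φ.recipCauchy a w with hg
  have h1 : (algebraMap ℂ A w - a) * R = 1 := mul_resolvent ha hw.ne'
  have haR : a * R = w • R - 1 := by
    rw [sub_mul, ← Algebra.smul_def] at h1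
    rw [← h1]; abel
  have hgG : g * φ R = w * φ R - 1 := by
    rw [hg, CState.recipCauchy, sub_mul, show φ R = φ.cauchy a w from rfl, inv_mul_cancel₀ hG]
  -- The element `v` is centred and satisfies `φ(a v) = g` and `φ((a² - m₂) v) = w g - m₂`. Both
  -- norm bounds are then Cauchy-Schwarz, once `φ(v* v)` is controlled.
  set v := a * R - g • R with hv
  have hwv : a * v = w • v - a + algebraMap ℂ A g := by
    rw [hv, mul_sub, mul_smul_comm, haR, mul_sub, mul_smul_comm, haR,
      Algebra.algebraMap_eq_smul_one, mul_one]
    module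
  have hφv : φ v = 0 := by
    rw [hv, map_sub, map_smul, haR, map_sub, map_smul, φ.apply_one, smul_eq_mul, smul_eq_mul, hgG]
    ring
  have hφav : φ (a * v) = g := by
    rw [hwv, map_add, map_sub, map_smul, hφv, h0, φ.apply_algebraMap]; simp
  have hm2 : (φ (a ^ 2)).re = (φ (star a * a)).re := by rw [ha.star_eq, sq]
  have hm2im : (φ (a ^ 2)).im = 0 := φ.im_apply_of_isSelfAdjoint (ha.pow 2)
  have hm2nn : 0 ≤ (φ (a ^ 2)).re := hm2 ▸ φ.re_apply_star_mul_self_nonneg a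
  have hN := Complex.nonneg_iff.1 (φ.nonneg v)
  -- Since `v* a v` is self-adjoint, `φ(v* a v)` is real; substituting `hwv` and taking imaginary
  -- parts gives the size of `v`.
  have hNle : w.im * (φ (star v * v)).re = - g.im := by
    have e1 : φ (star v * (a * v)) = w * φ (star v * v) - φ (star (a * v)) := by
      rw [hwv, mul_add, mul_sub, ← hwv, mul_smul_comm, map_add, map_sub, map_smul,
        ← Algebra.commutes, ← Algebra.smul_def, map_smul, φ.apply_star v, hφv, star_mul, ha.star_eq]
      simp
    have e2 : (φ (star v * (a * v))).im = 0 := by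
      apply φ.im_apply_of_isSelfAdjoint
      rw [IsSelfAdjoint, star_mul, star_mul, star_star, ha.star_eq, mul_assoc]
    rw [e1, φ.apply_star, hφav, Complex.sub_im, Complex.mul_im, ← hN.2, Complex.conj_im] at e2
    linarith
  have hcs : ‖g‖ ^ 2 ≤ (φ (a ^ 2)).re * (φ (star v * v)).re := by
    have := φ.norm_apply_star_mul_sq_le a v
    rwa [ha.star_eq, hφav, ← sq] at this
  have hgle : w.im * (φ (star v * v)).re ≤ ‖g‖ := by
    rw [hNle]; exact (neg_le_abs _).trans (Complex.abs_im_le_norm g)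
  have hgb : ‖g‖ ≤ (φ (a ^ 2)).re / w.im := by
    rw [le_div_iff₀ hw]
    rcases (norm_nonneg g).eq_or_lt with h | h
    · rw [← h, zero_mul]; exact hm2nn
    · have : ‖g‖ * (‖g‖ * w.im) ≤ ‖g‖ * (φ (a ^ 2)).re := by nlinarith
      exact le_of_mul_le_mul_left this h
  refine ⟨?_, hgb, ?_⟩
  · have : (φ.recipCauchy a w).im = w.im - g.im := by rw [hg, Complex.sub_im]; ring
    rw [this]
    nlinarith [mul_nonneg hw.le hN.1]
  · have hkey : w * g - φ (a ^ 2) =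
        φ (star (a ^ 2 - algebraMap ℂ A ((φ (a ^ 2)).re : ℂ)) * v) := by
      have e1 : a ^ 2 * v = w • (a * v) - a ^ 2 + g • a := by
        rw [sq, mul_assoc, hwv, mul_add, mul_sub, mul_smul_comm, ← hwv, ← Algebra.commutes,
          ← Algebra.smul_def]
      rw [star_sub, (ha.pow 2).star_eq, ← algebraMap_star_comm, RCLike.star_def, Complex.conj_ofReal,
        sub_mul, map_sub, e1, map_add, map_sub, map_smul, map_smul, hφav, h0, ← Algebra.smul_def,
        map_smul, hφv]
      simp
    have hcs2 := φ.norm_apply_star_mul_sq_le (a ^ 2 - algebraMap ℂ A ((φ (a ^ 2)).re : ℂ)) v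
    rw [← hkey] at hcs2
    have hs : (φ (star (a ^ 2 - algebraMap ℂ A ((φ (a ^ 2)).re : ℂ)) *
        (a ^ 2 - algebraMap ℂ A ((φ (a ^ 2)).re : ℂ)))).re
        = (φ (a ^ 4)).re - (φ (a ^ 2)).re ^ 2 := by
      rw [star_sub, (ha.pow 2).star_eq, ← algebraMap_star_comm, RCLike.star_def,
        Complex.conj_ofReal]
      rw [mul_sub, sub_mul, sub_mul, ← Algebra.commutes, ← map_mul, ← Algebra.smul_def, map_sub,
        map_sub, map_sub, map_smul, φ.apply_algebraMap, ← pow_add]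
      simp [hm2im]
      ring
    rw [hs] at hcs2
    have hs0 : 0 ≤ (φ (a ^ 4)).re - (φ (a ^ 2)).re ^ 2 := hs ▸ φ.re_apply_star_mul_self_nonneg _
    rw [le_div_iff₀ hw, ← Real.sqrt_mul hs0]
    apply Real.le_sqrt_of_sq_le
    have hv2 : w.im ^ 2 * (φ (star v * v)).re ≤ (φ (a ^ 2)).re := by
      have := (le_div_iff₀ hw).1 hgb
      nlinarith
    calc (‖w * g - φ (a ^ 2)‖ * w.im) ^ 2 = ‖w * g - φ (a ^ 2)‖ ^ 2 * w.im ^ 2 := by ring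
      _ ≤ ((φ (a ^ 4)).re - (φ (a ^ 2)).re ^ 2) * (φ (star v * v)).re * w.im ^ 2 := by gcongr
      _ = ((φ (a ^ 4)).re - (φ (a ^ 2)).re ^ 2) * (w.im ^ 2 * (φ (star v * v)).re) := by ring
      _ ≤ _ := by gcongr

theorem CState.sq_re_apply_sq_le (φ : CState A) (ha : IsSelfAdjoint a) :
    (φ (a ^ 2)).re ^ 2 ≤ (φ (a ^ 4)).re := by
  have h := φ.norm_apply_star_mul_sq_le 1 (a ^ 2)
  rw [star_one, one_mul, one_mul, φ.apply_one, Complex.one_re, one_mul, (ha.pow 2).star_eq,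
    ← pow_add] at h
  exact (sq_le_sq.2 ((Complex.abs_re_le_norm _).trans (le_abs_self _))).trans h

end OneVariable

/-! ### Monotone independence: factorization, Muraki's formula, moments. -/

section Monotone

theorem exists_list_prod_eq_of_mem_closure_image {M ι : Type*} [Monoid M] (y : ι → M) (s : Set ι)
    {x : M} (hx : x ∈ Submonoid.closure (y '' s)) :
    ∃ l : List ι, (∀ i ∈ l, i ∈ s) ∧ (l.map y).prod = x := by
  induction hx using Submonoid.closure_induction with
  | mem x hx =>
    obtain ⟨i, hi, rfl⟩ := hx
    exact ⟨[i], by simpa using hi, by simp⟩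
  | one => exact ⟨[], by simp, by simp⟩
  | mul a b _ _ ha hb =>
    obtain ⟨l, hl, rfl⟩ := ha
    obtain ⟨r, hr, rfl⟩ := hb
    refine ⟨l ++ r, fun i hi => ?_, by simp⟩
    rcases List.mem_append.1 hi with h | h
    exacts [hl i h, hr i h]

variable {B : Type*} [CStarAlgebra B] {ψ : CState B} {ι : Type*} [LinearOrder ι] {y : ι → B}

theorem MonotoneIndependentElements.apply_word (h : MonotoneIndependentElements ψ y)
    (l r : List ι) (k : ι) (m : ℕ) (hl : ∀ i ∈ l.getLast?, i < k) (hr : ∀ i ∈ r.head?, i < k) :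
    ψ ((l.map y).prod * y k ^ m * (r.map y).prod) =
      ψ (y k ^ m) * ψ ((l.map y).prod * (r.map y).prod) := by
  -- The power `0` is the unit, which the non-unital algebra need not contain; it is included so
  -- that constants in polynomials are covered later.
  rcases Nat.eq_zero_or_pos m with rfl | hm
  · rw [pow_zero, mul_one, ψ.apply_one, one_mul]
  have hy : ∀ i, y i ∈ NonUnitalAlgebra.adjoin ℂ {y i} := fun i =>
    NonUnitalAlgebra.subset_adjoin ℂ rfl
  have hpow : y k ^ m ∈ NonUnitalAlgebra.adjoin ℂ {y k} := by
    induction m, hm using Nat.le_induction with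
    | base => rw [pow_one]; exact hy k
    | succ m _ ih => rw [pow_succ]; exact mul_mem ih (hy k)
  have key := h (l.map fun i => (i, y i)) (r.map fun i => (i, y i)) k (y k ^ m)
    (fun p hp => by obtain ⟨i, _, rfl⟩ := List.mem_map.1 hp; exact hy i)
    (fun p hp => by obtain ⟨i, _, rfl⟩ := List.mem_map.1 hp; exact hy i) hpow
    (fun p hp => by
      rw [List.getLast?_map] at hp
      obtain ⟨i, hi, rfl⟩ := Option.mem_map.1 hp
      exact hl i hi)
    (fun p hp => by
      rw [List.head?_map] at hp
      obtain ⟨i, hi, rfl⟩ := Option.mem_map.1 hp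
      exact hr i hi)
  have e : ∀ t : List ι, ((t.map fun i => (i, y i)).map Prod.snd) = t.map y := fun t => by simp
  rw [e, e] at key
  exact key

theorem MonotoneIndependentElements.apply_list_mul (h : MonotoneIndependentElements ψ y)
    (l : List ι) (k : ι) (m : ℕ) (hl : ∀ i ∈ l.getLast?, i < k) {X : B}
    (hX : X ∈ Algebra.adjoin ℂ (y '' Set.Iio k)) :
    ψ ((l.map y).prod * y k ^ m * X) = ψ (y k ^ m) * ψ ((l.map y).prod * X) := by
  rw [← Subalgebra.mem_toSubmodule, Algebra.adjoin_eq_span] at hX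
  induction hX using Submodule.span_induction with
  | mem X hX =>
    obtain ⟨r, hr, rfl⟩ := exists_list_prod_eq_of_mem_closure_image y _ hX
    exact h.apply_word l r k m hl fun i hi => hr i (List.mem_of_mem_head? hi)
  | zero => simp
  | add a b _ _ ha hb => simp only [mul_add, map_add, ha, hb]
  | smul c a _ ha => simp only [mul_smul_comm, map_smul, ha, smul_eq_mul]; ring

theorem MonotoneIndependentElements.apply_pow_mul (h : MonotoneIndependentElements ψ y)
    (k : ι) (m : ℕ) {X : B} (hX : X ∈ Algebra.adjoin ℂ (y '' Set.Iio k)) :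
    ψ (y k ^ m * X) = ψ (y k ^ m) * ψ X := by
  simpa using h.apply_list_mul [] k m (by simp) hX

/-- Only the neighbours of the peak matter. The factor `x` supplies a left neighbour below `k`, so
`b` may involve all the variables, including `y k` itself. -/
theorem MonotoneIndependentElements.apply_mul_pow_mul (h : MonotoneIndependentElements ψ y)
    (k : ι) (m : ℕ) {b x X : B} (hb : b ∈ Algebra.adjoin ℂ (Set.range y))
    (hx : x ∈ Submodule.span ℂ (y '' Set.Iio k)) (hX : X ∈ Algebra.adjoin ℂ (y '' Set.Iio k)) :
    ψ (b * x * y k ^ m * X) = ψ (y k ^ m) * ψ (b * x * X) := by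
  induction hx using Submodule.span_induction with
  | zero => simp
  | add u v _ _ hu hv => simp only [mul_add, add_mul, map_add, hu, hv]
  | smul c u _ hu =>
    simp only [mul_smul_comm, smul_mul_assoc, map_smul, hu, smul_eq_mul]; ring
  | mem x hx =>
    obtain ⟨i, hi, rfl⟩ := hx
    rw [← Subalgebra.mem_toSubmodule, Algebra.adjoin_eq_span, ← Set.image_univ] at hb
    induction hb using Submodule.span_induction with
    | zero => simp
    | add u v _ _ hu hv => simp only [add_mul, map_add, hu, hv]; ring
    | smul c u _ hu => simp only [smul_mul_assoc, map_smul, hu, smul_eq_mul]; ring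
    | mem b hb =>
      obtain ⟨l, -, rfl⟩ := exists_list_prod_eq_of_mem_closure_image y _ hb
      have := h.apply_list_mul (l ++ [i]) k m (by simpa using hi) hX
      simpa [mul_assoc] using this

theorem mem_of_mem_closure_adjoin_singleton {A : Type*} [CStarAlgebra A] {C : Set A} {a R : A}
    (hC : IsClosed C) (hR : R ∈ closure (Algebra.adjoin ℂ {a} : Set A))
    (h : ∀ p ∈ Algebra.adjoin ℂ {a}, p ∈ C) : R ∈ C :=
  closure_minimal h hC hR

theorem apply_adjoin_of_apply_pow {A : Type*} [CStarAlgebra A] {a : A} (L M : A →ₗ[ℂ] ℂ)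
    (h : ∀ m : ℕ, L (a ^ m) = M (a ^ m)) {p : A} (hp : p ∈ Algebra.adjoin ℂ {a}) : L p = M p := by
  rw [← Subalgebra.mem_toSubmodule, Algebra.adjoin_singleton_eq_range_aeval] at hp
  obtain ⟨q, rfl⟩ := hp
  change L (Polynomial.aeval a q) = M (Polynomial.aeval a q)
  induction q using Polynomial.induction_on' with
  | add p q hp hq => rw [map_add, map_add, map_add, hp, hq]
  | monomial n c => rw [Polynomial.aeval_monomial, ← Algebra.smul_def, map_smul, map_smul, h n]

/-- Muraki's formula: the reciprocal Cauchy transform of a sum of monotone independent elements is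
the composition of the reciprocal Cauchy transforms. -/
theorem MonotoneIndependentElements.recipCauchy_add (h : MonotoneIndependentElements ψ y)
    (k : ι) {x : B} (hx : x ∈ Submodule.span ℂ (y '' Set.Iio k)) (hxs : IsSelfAdjoint x)
    (hys : IsSelfAdjoint (y k)) {z : ℂ} (hz : 0 < z.im) (hF : 0 < (ψ.recipCauchy (y k) z).im) :
    ψ.recipCauchy (x + y k) z = ψ.recipCauchy x (ψ.recipCauchy (y k) z) := by
  set w := ψ.recipCauchy (y k) z with hw
  have hG := ψ.cauchy_ne_zero hys hz
  have hs : IsSelfAdjoint (x + y k) := hxs.add hys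
  set R := resolvent (y k) z with hR
  set Q := resolvent x w with hQ
  set T := resolvent (x + y k) z with hT
  have hRcl := resolvent_mem_closure_adjoin hys hz.ne'
  have hQcl := resolvent_mem_closure_adjoin hxs hF.ne'
  have hTcl := resolvent_mem_closure_adjoin hs hz.ne'
  have hxadj : x ∈ Algebra.adjoin ℂ (y '' Set.Iio k) := by
    have := Submodule.span_le (p := (Algebra.adjoin ℂ (y '' Set.Iio k)).toSubmodule)|>.2
      Algebra.subset_adjoin
    exact this hx
  have hxadj' : x ∈ Algebra.adjoin ℂ (Set.range y) :=
    Algebra.adjoin_mono (Set.image_subset_range _ _) hxadj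
  have hle1 : Algebra.adjoin ℂ {x} ≤ Algebra.adjoin ℂ (y '' Set.Iio k) :=
    Algebra.adjoin_le (by simpa using hxadj)
  have hle2 : Algebra.adjoin ℂ {x + y k} ≤ Algebra.adjoin ℂ (Set.range y) :=
    Algebra.adjoin_le (by
      simpa using add_mem hxadj' (Algebra.subset_adjoin (Set.mem_range_self k)))
  have hcont := ψ.continuous
  have e1 : ψ (R * Q) = ψ R * ψ Q := by
    have s1 : ∀ p ∈ Algebra.adjoin ℂ {y k}, ∀ X ∈ Algebra.adjoin ℂ {x},
        ψ (p * X) = ψ p * ψ X := fun p hp X hX =>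
      apply_adjoin_of_apply_pow (ψ.toLinearMap ∘ₗ LinearMap.mulRight ℂ X)
        ((ψ X) • ψ.toLinearMap)
        (fun m => (h.apply_pow_mul k m (hle1 hX)).trans (mul_comm _ _)) hp |>.trans
        (mul_comm _ _)
    have s2 : ∀ X ∈ Algebra.adjoin ℂ {x}, ψ (R * X) = ψ R * ψ X := fun X hX =>
      mem_of_mem_closure_adjoin_singleton (C := {p | ψ (p * X) = ψ p * ψ X})
        (isClosed_eq (by fun_prop) (by fun_prop)) hRcl fun p hp => s1 p hp X hX
    exact mem_of_mem_closure_adjoin_singleton (C := {X | ψ (R * X) = ψ R * ψ X})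
        (isClosed_eq (by fun_prop) (by fun_prop)) hQcl s2
  -- The factorization holds for polynomials in the three elements; each is replaced by its
  -- resolvent in turn, by density and continuity.
  have e2 : ψ (T * x * R * Q) = ψ R * ψ (T * x * Q) := by
    have s1 : ∀ b ∈ Algebra.adjoin ℂ {x + y k}, ∀ p ∈ Algebra.adjoin ℂ {y k},
        ∀ X ∈ Algebra.adjoin ℂ {x}, ψ (b * x * p * X) = ψ p * ψ (b * x * X) :=
      fun b hb p hp X hX =>
      (apply_adjoin_of_apply_pow
        (ψ.toLinearMap ∘ₗ LinearMap.mulRight ℂ X ∘ₗ LinearMap.mulLeft ℂ (b * x))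
        ((ψ (b * x * X)) • ψ.toLinearMap)
        (fun m => (h.apply_mul_pow_mul k m (hle2 hb) hx (hle1 hX)).trans (mul_comm _ _)) hp).trans
        (mul_comm _ _)
    have s2 : ∀ b ∈ Algebra.adjoin ℂ {x + y k}, ∀ X ∈ Algebra.adjoin ℂ {x},
        ψ (b * x * R * X) = ψ R * ψ (b * x * X) := fun b hb X hX =>
      mem_of_mem_closure_adjoin_singleton (C := {p | ψ (b * x * p * X) = ψ p * ψ (b * x * X)})
        (isClosed_eq (by fun_prop) (by fun_prop)) hRcl fun p hp => s1 b hb p hp X hX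
    have s3 : ∀ b ∈ Algebra.adjoin ℂ {x + y k}, ψ (b * x * R * Q) = ψ R * ψ (b * x * Q) :=
      fun b hb =>
      mem_of_mem_closure_adjoin_singleton (C := {X | ψ (b * x * R * X) = ψ R * ψ (b * x * X)})
        (isClosed_eq (by fun_prop) (by fun_prop)) hQcl fun X hX => s2 b hb X hX
    exact mem_of_mem_closure_adjoin_singleton
      (C := {b | ψ (b * x * R * Q) = ψ R * ψ (b * x * Q)})
      (isClosed_eq (by fun_prop) (by fun_prop)) hTcl s3
  have hTm : T * (algebraMap ℂ B z - (x + y k)) = 1 := resolvent_mul hs hz.ne'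
  have hRm : (algebraMap ℂ B z - y k) * R = 1 := mul_resolvent hys hz.ne'
  have hQm : (algebraMap ℂ B w - x) * Q = 1 := mul_resolvent hxs hF.ne'
  have hxQ : x * Q = w • Q - 1 := by
    rw [sub_mul, ← Algebra.smul_def] at hQm
    rw [← hQm]; abel
  -- Applying `ψ` and using `x Q = w Q - 1` gives `ψ(R) ψ(Q) = ψ(TQ) - ψ(R) (w ψ(TQ) - ψ(T))`. The
  -- unknown `ψ(TQ)` cancels exactly because `w = 1/ψ(R)`, leaving `ψ(T) = ψ(Q)`.
  have e3 : R * Q = T * Q - T * x * R * Q := by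
    calc R * Q = T * (algebraMap ℂ B z - (x + y k)) * (R * Q) := by rw [hTm, one_mul]
      _ = T * ((algebraMap ℂ B z - y k) * R) * Q - T * x * R * Q := by noncomm_ring
      _ = _ := by rw [hRm, mul_one]
  have hwR : w * ψ R = 1 := inv_mul_cancel₀ hG
  have e4 : ψ T = w * ψ R * ψ Q := by
    have := congrArg (fun t => w * ψ t) e3
    simp only [map_sub] at this
    rw [e2, e1, mul_assoc T, hxQ, mul_sub T, mul_smul_comm, map_sub, map_smul, smul_eq_mul,
      mul_one] at this
    linear_combination (-1) * this + (w * ψ (T * Q) - ψ T) * hwR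
  rw [hwR, one_mul] at e4
  rw [CState.recipCauchy, CState.recipCauchy, CState.cauchy, CState.cauchy, ← hT, e4]

/-- The fourth moment of a sum of centered monotone independent elements. -/
theorem MonotoneIndependentElements.moments_add (h : MonotoneIndependentElements ψ y)
    (k : ι) {x : B} (hx : x ∈ Submodule.span ℂ (y '' Set.Iio k)) (hx0 : ψ x = 0)
    (hy0 : ψ (y k) = 0) :
    ψ ((x + y k) ^ 2) = ψ (x ^ 2) + ψ (y k ^ 2) ∧
    ψ ((x + y k) ^ 4) = ψ (x ^ 4) + 3 * ψ (y k ^ 2) * ψ (x ^ 2) + ψ (y k ^ 4) := by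
  have hxadj : x ∈ Algebra.adjoin ℂ (y '' Set.Iio k) := by
    have := Submodule.span_le (p := (Algebra.adjoin ℂ (y '' Set.Iio k)).toSubmodule)|>.2
      Algebra.subset_adjoin
    exact this hx
  have hxadj' : x ∈ Algebra.adjoin ℂ (Set.range y) :=
    Algebra.adjoin_mono (Set.image_subset_range _ _) hxadj
  have hyadj : y k ∈ Algebra.adjoin ℂ (Set.range y) :=
    Algebra.subset_adjoin (Set.mem_range_self k)
  have P := fun (m j : ℕ) => h.apply_pow_mul k m (pow_mem hxadj j)
  have W := fun (b : B) (hb : b ∈ Algebra.adjoin ℂ (Set.range y)) (m j : ℕ) =>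
    h.apply_mul_pow_mul k m hb hx (pow_mem hxadj j)
  generalize y k = u at *
  have one_mem' := one_mem (Algebra.adjoin ℂ (Set.range y))
  constructor
  · have e : (x + u) ^ 2 = x ^ 2 + 1 * x * u ^ 1 * x ^ 0 + u ^ 1 * x ^ 1 + u ^ 2 := by
      noncomm_ring
    rw [e]
    simp only [map_add, W 1 one_mem', P]
    simp [hy0]
  -- The factors `1`, `u ^ 1` and `x ^ 0` put the words containing `u`, apart from pure powers, into
  -- the shape of `P` or `W`. The mixed words that survive are `u²x²`, `xu²x` and `x²u²`, whence the
  -- coefficient `3`.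
  · have e : (x + u) ^ 4 = x ^ 4 + u ^ 1 * x ^ 3 + 1 * x * u ^ 1 * x ^ 2 + x * x * u ^ 1 * x ^ 1
        + x ^ 2 * x * u ^ 1 * x ^ 0 + u ^ 2 * x ^ 2 + u * x * u ^ 1 * x ^ 1
        + (u * x) * x * u ^ 1 * x ^ 0 + 1 * x * u ^ 2 * x ^ 1 + (x * u) * x * u ^ 1 * x ^ 0
        + x * x * u ^ 2 * x ^ 0 + u ^ 3 * x ^ 1 + u ^ 2 * x * u ^ 1 * x ^ 0
        + u * x * u ^ 2 * x ^ 0 + 1 * x * u ^ 3 * x ^ 0 + u ^ 4 := by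
      noncomm_ring
    rw [e]
    simp only [map_add, P, W 1 one_mem', W x hxadj', W (x ^ 2) (pow_mem hxadj' 2),
      W u hyadj, W (u * x) (mul_mem hyadj hxadj'), W (x * u) (mul_mem hxadj' hyadj),
      W (u ^ 2) (pow_mem hyadj 2)]
    have ux := P 1 1
    simp only [pow_one, hy0, zero_mul] at ux
    simp only [pow_one, pow_zero, hy0, hx0, zero_mul, mul_zero, add_zero, mul_one, one_mul, ux,
      ← sq]
    ring

end Monotone

/-! ### Iteration over the summands and the limit of infinitely many summands. -/

section Divisible

/-- Expand `(f w)² = w² - 2 w (w - f w) + (w - f w)²`. The imaginary part never decreases along the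
orbit, so each step has an error bounded in terms of the initial `z.im`, and the errors add. -/
theorem iterate_sq_sub_le {f : ℂ → ℂ} {p s : ℝ} (hp : 0 ≤ p) (hs : 0 ≤ s)
    (hf : ∀ w : ℂ, 0 < w.im → w.im ≤ (f w).im ∧ ‖w - f w‖ ≤ p / w.im ∧
      ‖w * (w - f w) - p‖ ≤ s / w.im) {z : ℂ} (hz : 0 < z.im) (k : ℕ) :
    z.im ≤ (f^[k] z).im ∧
      ‖(f^[k] z) ^ 2 - (z ^ 2 - 2 * k * p)‖ ≤ k * (2 * (s / z.im) + (p / z.im) ^ 2) := by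
  induction k with
  | zero => simp
  | succ k ih =>
    obtain ⟨h1, h2⟩ := ih
    rw [Function.iterate_succ_apply']
    set w := f^[k] z
    have hw : 0 < w.im := hz.trans_le h1
    obtain ⟨g1, g2, g3⟩ := hf w hw
    refine ⟨h1.trans g1, ?_⟩
    have g2' : ‖w - f w‖ ≤ p / z.im := g2.trans (div_le_div_of_nonneg_left hp hz h1)
    have g3' : ‖w * (w - f w) - p‖ ≤ s / z.im := g3.trans (div_le_div_of_nonneg_left hs hz h1)
    have e : f w ^ 2 - (z ^ 2 - 2 * ((k + 1 : ℕ) : ℂ) * p) =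
        (w ^ 2 - (z ^ 2 - 2 * k * p)) - 2 * (w * (w - f w) - p) + (w - f w) ^ 2 := by
      push_cast; ring
    rw [e]
    calc _ ≤ ‖w ^ 2 - (z ^ 2 - 2 * k * p)‖ + ‖2 * (w * (w - f w) - p)‖ + ‖(w - f w) ^ 2‖ :=
          (norm_add_le _ _).trans (add_le_add_left (norm_sub_le _ _) _)
      _ ≤ k * (2 * (s / z.im) + (p / z.im) ^ 2) + 2 * (s / z.im) + (p / z.im) ^ 2 := by
          rw [norm_mul, norm_pow, Complex.norm_ofNat]
          gcongr
      _ = _ := by push_cast; ring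

theorem CState.recipCauchy_zero {B : Type*} [CStarAlgebra B] (ψ : CState B) {z : ℂ}
    (hz : z.im ≠ 0) : ψ.recipCauchy 0 z = z := by
  have hz0 : z ≠ 0 := by rintro rfl; exact hz rfl
  have : resolvent (0 : B) z = algebraMap ℂ B z⁻¹ :=
    resolvent_eq_of_mul_eq_one (IsSelfAdjoint.zero _) hz (by
      rw [sub_zero, ← map_mul, mul_inv_cancel₀ hz0, map_one])
  rw [CState.recipCauchy, CState.cauchy, this, ψ.apply_algebraMap, inv_inv]

variable {B : Type*} [CStarAlgebra B] {ψ : CState B} {n : ℕ} {y : Fin n → B}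

/-- The sum of the first `k` members of a finite sequence. -/
def partialSum (y : Fin n → B) (k : ℕ) : B := ∑ i with i.val < k, y i

theorem partialSum_zero (y : Fin n → B) : partialSum y 0 = 0 := by simp [partialSum]

theorem partialSum_self (y : Fin n → B) : partialSum y n = ∑ i, y i := by simp [partialSum]

theorem partialSum_succ (y : Fin n → B) {k : ℕ} (hk : k < n) :
    partialSum y (k + 1) = partialSum y k + y ⟨k, hk⟩ := by
  have : (Finset.univ.filter fun i : Fin n => i.val < k + 1) =
      insert ⟨k, hk⟩ (Finset.univ.filter fun i : Fin n => i.val < k) := by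
    ext i
    simp only [Finset.mem_filter, Finset.mem_univ, true_and, Finset.mem_insert, Fin.ext_iff]
    omega
  rw [partialSum, this, Finset.sum_insert (by simp), add_comm, partialSum]

theorem partialSum_mem_span (y : Fin n → B) {k : ℕ} (hk : k < n) :
    partialSum y k ∈ Submodule.span ℂ (y '' Set.Iio ⟨k, hk⟩) :=
  Submodule.sum_mem _ fun i hi => Submodule.subset_span
    ⟨i, by simpa [Fin.lt_def] using hi, rfl⟩

theorem isSelfAdjoint_partialSum (hy : ∀ i, IsSelfAdjoint (y i)) (k : ℕ) :
    IsSelfAdjoint (partialSum y k) := by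
  rw [IsSelfAdjoint, partialSum, star_sum]
  exact Finset.sum_congr rfl fun i _ => (hy i).star_eq

/-- Adding a summand to `k` earlier ones contributes `m₄ + 3 m₂ · k m₂` to the fourth moment;
summing `3k` gives `3/2 · k (k - 1)`, the origin of the constant `3/2`. -/
theorem MonotoneIndependentElements.moments_partialSum (h : MonotoneIndependentElements ψ y)
    {m₂ m₄ : ℂ} (h1 : ∀ i, ψ (y i) = 0) (h2 : ∀ i, ψ (y i ^ 2) = m₂)
    (h4 : ∀ i, ψ (y i ^ 4) = m₄) {k : ℕ} (hk : k ≤ n) :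
    ψ (partialSum y k) = 0 ∧ ψ (partialSum y k ^ 2) = k * m₂ ∧
      ψ (partialSum y k ^ 4) = k * m₄ + 3 / 2 * (k * (k - 1)) * m₂ ^ 2 := by
  induction k with
  | zero => simp [partialSum_zero]
  | succ k ih =>
    obtain ⟨e1, e2, e4⟩ := ih (by omega)
    obtain ⟨g2, g4⟩ := h.moments_add ⟨k, hk⟩ (partialSum_mem_span y hk) e1 (h1 _)
    rw [partialSum_succ y hk, map_add, e1, h1, g2, g4, e2, e4, h2, h4]
    push_cast
    exact ⟨by ring, by ring, by ring⟩

theorem MonotoneIndependentElements.recipCauchy_partialSum (h : MonotoneIndependentElements ψ y)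
    (hy : ∀ i, IsSelfAdjoint (y i)) {f : ℂ → ℂ} (hf : ∀ i z, 0 < z.im → ψ.recipCauchy (y i) z = f z)
    (hf_im : ∀ z, 0 < z.im → z.im ≤ (f z).im) {k : ℕ} (hk : k ≤ n) {z : ℂ} (hz : 0 < z.im) :
    ψ.recipCauchy (partialSum y k) z = f^[k] z := by
  induction k generalizing z with
  | zero => rw [partialSum_zero, ψ.recipCauchy_zero hz.ne']; rfl
  | succ k ih =>
    have hfz : 0 < (f z).im := hz.trans_le (hf_im z hz)
    rw [partialSum_succ y hk, h.recipCauchy_add ⟨k, hk⟩ (partialSum_mem_span y hk)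
      (isSelfAdjoint_partialSum hy k) (hy _) hz (by rwa [hf _ _ hz]), hf _ _ hz,
      ih (by omega) hfz, Function.iterate_succ_apply]

/-- The reciprocal Cauchy transform of a normalized sum of `n` identically distributed monotone
independent elements is close to that of the arcsine law if the fourth moment is close
to `3 / 2`. -/
theorem MonotoneIndependentElements.recipCauchy_sum_sq_sub (h : MonotoneIndependentElements ψ y)
    (hn : 1 ≤ n) (hy : ∀ i, IsSelfAdjoint (y i)) (hid : ∀ i j, SameMoments ψ (y i) ψ (y j))
    (hm1 : ψ (∑ i, y i) = 0) (hm2 : ψ ((∑ i, y i) ^ 2) = 1) :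
    3 / 2 - 1 / (2 * n) ≤ (ψ ((∑ i, y i) ^ 4)).re ∧
    ∀ z : ℂ, 0 < z.im → z.im ≤ (ψ.recipCauchy (∑ i, y i) z).im ∧
      ‖ψ.recipCauchy (∑ i, y i) z ^ 2 - (z ^ 2 - 2)‖ ≤
        2 * Real.sqrt ((ψ ((∑ i, y i) ^ 4)).re - 3 / 2 + 1 / (2 * n)) / z.im
          + 1 / n / z.im ^ 2 := by
  have hn0 : (n : ℝ) ≠ 0 := by positivity
  have hn0' : (n : ℂ) ≠ 0 := by exact_mod_cast hn0
  have hnpos : (0 : ℝ) < n := by positivity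
  set a := y ⟨0, hn⟩ with ha
  have has : IsSelfAdjoint a := hy _
  have h1 : ∀ i, ψ (y i) = ψ a := fun i => by simpa using hid i ⟨0, hn⟩ 1
  have ha1 : ψ a = 0 := by
    rw [map_sum, Finset.sum_congr rfl fun i _ => h1 i, Finset.sum_const, Finset.card_univ,
      Fintype.card_fin, nsmul_eq_mul] at hm1
    exact (mul_eq_zero.1 hm1).resolve_left hn0'
  obtain ⟨-, e2, e4⟩ := h.moments_partialSum (fun i => (h1 i).trans ha1)
    (fun i => hid i ⟨0, hn⟩ 2) (fun i => hid i ⟨0, hn⟩ 4) le_rfl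
  rw [partialSum_self, hm2, ← ha] at e2
  rw [partialSum_self, ← ha] at e4
  have ha2 : ψ (a ^ 2) = ((1 / n : ℝ) : ℂ) := by
    push_cast
    field_simp
    rw [mul_comm, ← e2]
  have hre2 : (ψ (a ^ 2)).re = 1 / n := by rw [ha2, Complex.ofReal_re]
  -- With `m₂ = 1/n`, the term `3/2 · n (n - 1) m₂²` is `3/2 - 3/(2n)`, and `n m₂² = 1/n` accounts
  -- for the remaining `1/(2n)`.
  have hre4 : (ψ ((∑ i, y i) ^ 4)).re - 3 / 2 + 1 / (2 * n) =
      n * ((ψ (a ^ 4)).re - (ψ (a ^ 2)).re ^ 2) := by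
    rw [e4, ha2, ← Complex.ofReal_pow, ← Complex.ofReal_natCast]
    have : (3 / 2 * ((n : ℝ) * ((n : ℝ) - 1)) * ((1 / n : ℝ) ^ 2 : ℝ) : ℂ) =
        ((3 / 2 * (n * (n - 1)) * (1 / n) ^ 2 : ℝ) : ℂ) := by push_cast; ring
    rw [this, Complex.add_re, Complex.ofReal_re, Complex.re_ofReal_mul, Complex.ofReal_re]
    field_simp
    ring
  have hvar : 0 ≤ (ψ (a ^ 4)).re - (ψ (a ^ 2)).re ^ 2 := sub_nonneg.2 (ψ.sq_re_apply_sq_le has)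
  refine ⟨by nlinarith [mul_nonneg hnpos.le hvar], fun z hz => ?_⟩
  have hfi : ∀ i z, 0 < z.im → ψ.recipCauchy (y i) z = ψ.recipCauchy a z := fun i z hz => by
    rw [CState.recipCauchy, CState.recipCauchy, (hid i ⟨0, hn⟩).cauchy_eq (hy i) has hz.ne']
  have hb := fun (w : ℂ) (hw : 0 < w.im) => ψ.recipCauchy_bounds has ha1 hw
  have hiter := h.recipCauchy_partialSum hy hfi (fun w hw => (hb w hw).1) le_rfl hz
  rw [partialSum_self] at hiter
  rw [hiter]
  have := iterate_sq_sub_le (f := ψ.recipCauchy a) (p := 1 / n)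
    (s := Real.sqrt ((ψ (a ^ 4)).re - (ψ (a ^ 2)).re ^ 2) * Real.sqrt (ψ (a ^ 2)).re)
    (by positivity) (by positivity)
    (fun w hw => ⟨(hb w hw).1, hre2 ▸ (hb w hw).2.1, by rw [← ha2]; exact (hb w hw).2.2⟩) hz n
  refine ⟨this.1, ?_⟩
  have h2 : (2 * n * ((1 / n : ℝ) : ℂ)) = 2 := by push_cast; field_simp
  rw [h2] at this
  refine this.2.trans (le_of_eq ?_)
  rw [hre4, hre2]
  -- The factor `√m₂ = n^(-1/2)` turns the sum of `n` equal errors into one square root, bounded as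
  -- `n` grows.
  have hsq : Real.sqrt (n * ((ψ (a ^ 4)).re - (1 / n) ^ 2)) =
      n * (Real.sqrt ((ψ (a ^ 4)).re - (1 / n) ^ 2) * Real.sqrt (1 / n)) := by
    rw [hre2] at hvar
    rw [Real.sqrt_mul hnpos.le, Real.sqrt_div zero_le_one, Real.sqrt_one]
    have := Real.mul_self_sqrt hnpos.le
    have h0 : Real.sqrt n ≠ 0 := (Real.sqrt_pos.2 hnpos).ne'
    field_simp
    rw [sq, this]
  rw [hsq]
  field_simp

end Divisible

open Filter Topology in
/-- The reciprocal Cauchy transform of a normalized monotone infinitely divisible element is close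
to that of the arcsine law if the fourth moment is close to `3 / 2`. -/
theorem IsMonotoneInfinitelyDivisible.recipCauchy_sq_sub {A : Type u} [CStarAlgebra A]
    {φ : CState A} {Y : A} (h : IsMonotoneInfinitelyDivisible.{u, v} φ Y) (hY : IsSelfAdjoint Y)
    (h1 : φ Y = 0) (h2 : φ (Y ^ 2) = 1) :
    3 / 2 ≤ (φ (Y ^ 4)).re ∧
    ∀ z : ℂ, 0 < z.im → z.im ≤ (φ.recipCauchy Y z).im ∧
      ‖φ.recipCauchy Y z ^ 2 - (z ^ 2 - 2)‖ ≤ 2 * Real.sqrt ((φ (Y ^ 4)).re - 3 / 2) / z.im := by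
  -- The algebra depends on `n`, but equality of moments moves the estimate to `Y`, so that only the
  -- explicit `1/n` terms vary in the limit.
  have key : ∀ n : ℕ, 1 ≤ n → 3 / 2 - 1 / (2 * n) ≤ (φ (Y ^ 4)).re ∧
      ∀ z : ℂ, 0 < z.im → z.im ≤ (φ.recipCauchy Y z).im ∧
      ‖φ.recipCauchy Y z ^ 2 - (z ^ 2 - 2)‖ ≤
        2 * Real.sqrt ((φ (Y ^ 4)).re - 3 / 2 + 1 / (2 * n)) / z.im
          + 1 / n / z.im ^ 2 := by
    intro n hn
    obtain ⟨B, _, ψ, y, hy, hid, hmon, hsame⟩ := h n hn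
    have hs : IsSelfAdjoint (∑ i, y i) := partialSum_self y ▸ isSelfAdjoint_partialSum hy n
    have e1 : ψ (∑ i, y i) = 0 := by rw [← h1]; simpa using (hsame 1).symm
    obtain ⟨g4, g⟩ := hmon.recipCauchy_sum_sq_sub hn hy hid e1 ((hsame 2).symm.trans h2)
    rw [← hsame 4] at g4 g
    refine ⟨g4, fun z hz => ?_⟩
    rw [CState.recipCauchy, hsame.cauchy_eq hY hs hz.ne']
    exact g z hz
  have t1 : Tendsto (fun n : ℕ => 1 / (n : ℝ)) atTop (𝓝 0) := tendsto_one_div_atTop_nhds_zero_nat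
  have t2 : Tendsto (fun n : ℕ => 1 / (2 * (n : ℝ))) atTop (𝓝 0) := by
    have := t1.const_mul (1 / 2)
    rw [mul_zero] at this
    refine this.congr fun n => ?_
    rw [one_div_mul_one_div]
  refine ⟨?_, fun z hz => ⟨((key 1 le_rfl).2 z hz).1, ?_⟩⟩
  · refine le_of_tendsto (f := fun n : ℕ => 3 / 2 - 1 / (2 * (n : ℝ))) ?_
      (eventually_atTop.2 ⟨1, fun n hn => (key n hn).1⟩)
    simpa using t2.const_sub (3 / 2)
  · refine ge_of_tendsto (f := fun n : ℕ =>
      2 * Real.sqrt ((φ (Y ^ 4)).re - 3 / 2 + 1 / (2 * n)) / z.im + 1 / n / z.im ^ 2) ?_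
      (eventually_atTop.2 ⟨1, fun n hn => ((key n hn).2 z hz).2⟩)
    have t3 := ((((Real.continuous_sqrt.tendsto _).comp
      (t2.const_add ((φ (Y ^ 4)).re - 3 / 2))).const_mul 2).div_const z.im).add
      (t1.div_const (z.im ^ 2))
    simpa using t3

/-! ### The distribution as a probability measure, and its Poisson integral. -/

section Distribution

open Filter Topology

/-- A continuous cutoff function, equal to `1` on `[-r, r]` and to `0` outside of
`[-r - 1, r + 1]`. -/
def cutoff (r t : ℝ) : ℝ := max 0 (min 1 (r + 1 - |t|))

theorem continuous_cutoff (r : ℝ) : Continuous (cutoff r) := by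
  unfold cutoff; fun_prop

theorem cutoff_nonneg (r t : ℝ) : 0 ≤ cutoff r t := le_max_left _ _

theorem cutoff_le_one (r t : ℝ) : cutoff r t ≤ 1 := max_le zero_le_one (min_le_left _ _)

theorem cutoff_eq_one {r t : ℝ} (h : |t| ≤ r) : cutoff r t = 1 := by
  rw [cutoff, min_eq_left (by linarith), max_eq_right zero_le_one]

theorem hasCompactSupport_cutoff (r : ℝ) : HasCompactSupport (cutoff r) := by
  refine HasCompactSupport.intro (isCompact_Icc (a := -(r + 1)) (b := r + 1)) fun t ht => ?_
  rw [Set.mem_Icc, ← abs_le, not_le] at ht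
  exact max_eq_left ((min_le_right _ _).trans (by linarith))

/-- The product of a continuous function with a cutoff. -/
def cutoffMul {f : ℝ → ℝ} (hf : Continuous f) (r : ℝ) : C_c(ℝ, ℝ) where
  toFun t := f t * cutoff r t
  continuous_toFun := hf.mul (continuous_cutoff r)
  hasCompactSupport' := (hasCompactSupport_cutoff r).mul_left

variable {A : Type*} [CStarAlgebra A] (φ : CState A) (a : A)

instance : (φ.distribution a).Regular := by unfold CState.distribution; infer_instance

/-- The cutoff equals `1` on the spectrum, so it is invisible to the functional calculus. -/
theorem CState.integral_cutoffMul_distribution {f : ℝ → ℝ} (hf : Continuous f) {r : ℝ}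
    (hr : ‖a‖ * ‖(1 : A)‖ ≤ r) :
    ∫ t, f t * cutoff r t ∂(φ.distribution a) = (φ (cfc f a)).re := by
  have h := RealRMK.integral_rieszMeasure (φ.functional a) (cutoffMul hf r)
  change ∫ t, f t * cutoff r t ∂(φ.distribution a) =
    (φ (cfc (fun t => f t * cutoff r t) a)).re at h
  rw [h]
  congr 2
  refine cfc_congr fun t ht => ?_
  have : ‖t‖ ≤ r := (spectrum.norm_le_norm_mul_of_mem ht).trans hr
  rw [cutoff_eq_one this, mul_one]

variable {a}

theorem CState.integral_cutoff_distribution (ha : IsSelfAdjoint a) {r : ℝ}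
    (hr : ‖a‖ * ‖(1 : A)‖ ≤ r) : ∫ t, cutoff r t ∂(φ.distribution a) = 1 := by
  have h := φ.integral_cutoffMul_distribution a (f := fun _ => 1) continuous_const hr
  simp only [one_mul] at h
  rw [h, cfc_const_one ℝ a ha, φ.apply_one, Complex.one_re]

/-- Large intervals have mass at most `1`, by comparison with a cutoff of integral `φ(1) = 1`; they
exhaust the line. -/
theorem CState.isFiniteMeasure_distribution (ha : IsSelfAdjoint a) :
    IsFiniteMeasure (φ.distribution a) := by
  have hball : ∀ n : ℕ, ‖a‖ * ‖(1 : A)‖ ≤ n →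
      φ.distribution a (Set.Icc (-(n : ℝ)) n) ≤ 1 := by
    intro n hn
    have hfin : φ.distribution a (Set.Icc (-(n : ℝ)) n) ≠ ⊤ := isCompact_Icc.measure_ne_top
    rw [← ENNReal.ofReal_toReal hfin, ← ENNReal.ofReal_one]
    refine ENNReal.ofReal_le_ofReal ?_
    rw [← φ.integral_cutoff_distribution ha hn]
    change (φ.distribution a).real _ ≤ _
    rw [← integral_indicator_one measurableSet_Icc]
    refine integral_mono ?_ ((continuous_cutoff _).integrable_of_hasCompactSupport
      (hasCompactSupport_cutoff _)) fun t => ?_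
    · exact (integrable_indicator_iff measurableSet_Icc).2 (integrableOn_const hfin)
    · by_cases ht : t ∈ Set.Icc (-(n : ℝ)) n
      · rw [Set.indicator_of_mem ht, cutoff_eq_one (abs_le.2 ht)]; rfl
      · rw [Set.indicator_of_notMem ht]; exact cutoff_nonneg _ _
  have hmono : Monotone fun n : ℕ => Set.Icc (-(n : ℝ)) n := fun m n hmn =>
    Set.Icc_subset_Icc (by simpa using hmn) (by simpa using hmn)
  have hU : ⋃ n : ℕ, Set.Icc (-(n : ℝ)) n = Set.univ := by
    refine Set.eq_univ_of_forall fun t => Set.mem_iUnion.2 ?_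
    obtain ⟨n, hn⟩ := exists_nat_ge |t|
    exact ⟨n, abs_le.1 hn⟩
  have ht := tendsto_measure_iUnion_atTop (μ := φ.distribution a) hmono
  rw [hU] at ht
  obtain ⟨N, hN⟩ := exists_nat_ge (‖a‖ * ‖(1 : A)‖)
  refine ⟨(le_of_tendsto ht (eventually_atTop.2 ⟨N, fun n hn => ?_⟩)).trans_lt ENNReal.one_lt_top⟩
  exact hball n (hN.trans (by exact_mod_cast hn))

/-- The defining property of the distribution extends to bounded continuous functions. -/
theorem CState.integral_distribution (ha : IsSelfAdjoint a) {f : ℝ → ℝ} (hf : Continuous f)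
    {C : ℝ} (hC : ∀ t, |f t| ≤ C) : ∫ t, f t ∂(φ.distribution a) = (φ (cfc f a)).re := by
  have := φ.isFiniteMeasure_distribution ha
  obtain ⟨N, hN⟩ := exists_nat_ge (‖a‖ * ‖(1 : A)‖)
  have hlim : Tendsto (fun n : ℕ => ∫ t, f t * cutoff n t ∂(φ.distribution a)) atTop
      (𝓝 (∫ t, f t ∂(φ.distribution a))) := by
    refine tendsto_integral_of_dominated_convergence (fun _ => C)
      (fun n => (hf.mul (continuous_cutoff _)).aestronglyMeasurable) (integrable_const C)
      (fun n => Eventually.of_forall fun t => ?_) (Eventually.of_forall fun t => ?_)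
    · rw [norm_mul, Real.norm_eq_abs, Real.norm_eq_abs, abs_of_nonneg (cutoff_nonneg _ _)]
      exact (mul_le_of_le_one_right (abs_nonneg _) (cutoff_le_one _ _)).trans (hC t)
    · obtain ⟨M, hM⟩ := exists_nat_ge |t|
      refine tendsto_const_nhds.congr' (eventually_atTop.2 ⟨M, fun n hn => ?_⟩)
      change f t = f t * cutoff n t
      rw [cutoff_eq_one (hM.trans (by exact_mod_cast hn)), mul_one]
  refine tendsto_nhds_unique hlim (tendsto_const_nhds.congr' (eventually_atTop.2 ⟨N, fun n hn => ?_⟩))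
  exact (φ.integral_cutoffMul_distribution a hf (hN.trans (by exact_mod_cast hn))).symm

theorem CState.isProbabilityMeasure_distribution (ha : IsSelfAdjoint a) :
    IsProbabilityMeasure (φ.distribution a) := by
  have := φ.isFiniteMeasure_distribution ha
  have h := φ.integral_distribution ha (f := fun _ => 1) continuous_const (C := 1) (by simp)
  rw [cfc_const_one ℝ a ha, φ.apply_one, Complex.one_re, integral_const, smul_eq_mul,
    mul_one] at h
  exact ⟨by rw [← ofReal_measureReal, h, ENNReal.ofReal_one]⟩

/-- The denominator is `(z - x)(z̄ - x)` with `z = t + iη`, so the kernel of `a` times `(z - a)(z̄ -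
a)` is `η`; then multiply by the inverses. -/
theorem cfc_poisson_eq_smul (ha : IsSelfAdjoint a) {η : ℝ} (hη : 0 < η) (t : ℝ) :
    cfc (fun x : ℝ => η / ((t - x) ^ 2 + η ^ 2)) a =
      (η : ℂ) • (star (resolvent a (t + η * I)) * resolvent a (t + η * I)) := by
  set z : ℂ := t + η * I with hz
  have hzi : z.im = η := by simp [hz]
  have hz0 : z.im ≠ 0 := hzi ▸ hη.ne'
  set R := resolvent a z
  have h1 : (algebraMap ℂ A z - a) * R = 1 := mul_resolvent ha hz0
  have h2 : star R * (algebraMap ℂ A ((starRingEnd ℂ) z) - a) = 1 := star_resolvent ha hz0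
  have h2' : (algebraMap ℂ A ((starRingEnd ℂ) z) - a) * star R = 1 := by
    have h := congrArg star (resolvent_mul (a := a) ha hz0)
    rwa [star_mul, star_sub, ha.star_eq, star_one, ← algebraMap_star_comm] at h
  have hden : ∀ x : ℝ, (t - x) ^ 2 + η ^ 2 ≠ 0 := fun x => by positivity
  have hcont : Continuous fun x : ℝ => η / ((t - x) ^ 2 + η ^ 2) :=
    continuous_const.div (by fun_prop) hden
  have hprod : cfc (fun x : ℝ => η / ((t - x) ^ 2 + η ^ 2)) a *
      cfc (fun x : ℝ => (t - x) ^ 2 + η ^ 2) a = algebraMap ℂ A η := by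
    rw [← cfc_mul _ _ a hcont.continuousOn (by fun_prop),
      cfc_congr (g := fun _ : ℝ => η) (fun x _ => div_mul_cancel₀ _ (hden x)), cfc_const _ _ ha,
      IsScalarTower.algebraMap_apply ℝ ℂ A]
    rfl
  have hq : cfc (fun x : ℝ => (t - x) ^ 2 + η ^ 2) a =
      (algebraMap ℂ A z - a) * (algebraMap ℂ A ((starRingEnd ℂ) z) - a) := by
    rw [cfc_add _ _ _ (by fun_prop) (by fun_prop), cfc_pow _ _ _ (by fun_prop) ,
      cfc_sub _ _ _ (by fun_prop) (by fun_prop), cfc_const _ _ ha, cfc_const _ _ ha,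
      cfc_id' ℝ _ ha]
    have e1 : (algebraMap ℂ A z - a) * (algebraMap ℂ A ((starRingEnd ℂ) z) - a) =
        algebraMap ℂ A (z * (starRingEnd ℂ) z) - (z + (starRingEnd ℂ) z) • a + a * a := by
      rw [map_mul, add_smul, Algebra.smul_def, Algebra.smul_def, mul_sub, sub_mul, sub_mul,
        ← Algebra.commutes _ a]
      abel
    have e2 : z * (starRingEnd ℂ) z = ((t ^ 2 + η ^ 2 : ℝ) : ℂ) := by
      rw [Complex.mul_conj, Complex.normSq_apply]
      simp [hz]; ring
    have e3 : z + (starRingEnd ℂ) z = ((2 * t : ℝ) : ℂ) := by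
      rw [Complex.add_conj]; simp [hz]
    rw [e1, e2, e3, Complex.coe_smul, sq (_ - a), mul_sub, sub_mul, sub_mul,
      ← Algebra.commutes _ a, ← map_mul]
    simp only [Algebra.algebraMap_eq_smul_one, smul_mul_assoc, one_mul, Complex.coe_smul]
    module
  rw [hq] at hprod
  calc cfc (fun x : ℝ => η / ((t - x) ^ 2 + η ^ 2)) a
      = cfc (fun x : ℝ => η / ((t - x) ^ 2 + η ^ 2)) a * ((algebraMap ℂ A z - a) *
          ((algebraMap ℂ A ((starRingEnd ℂ) z) - a) * star R) * R) := by
        rw [h2', mul_one, h1, mul_one]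
    _ = (cfc (fun x : ℝ => η / ((t - x) ^ 2 + η ^ 2)) a * ((algebraMap ℂ A z - a) *
          (algebraMap ℂ A ((starRingEnd ℂ) z) - a))) * (star R * R) := by noncomm_ring
    _ = _ := by rw [hprod, Algebra.smul_def]

/-- Stieltjes inversion: the Poisson integral of the distribution is the imaginary part of the
Cauchy transform. -/
theorem CState.integral_poisson_distribution (ha : IsSelfAdjoint a) {η : ℝ} (hη : 0 < η) (t : ℝ) :
    ∫ x, η / ((t - x) ^ 2 + η ^ 2) ∂(φ.distribution a) = -(φ.cauchy a (t + η * I)).im := by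
  have hden : ∀ x : ℝ, (t - x) ^ 2 + η ^ 2 ≠ 0 := fun x => by positivity
  have hcont : Continuous fun x : ℝ => η / ((t - x) ^ 2 + η ^ 2) :=
    continuous_const.div (by fun_prop) hden
  rw [φ.integral_distribution ha hcont (C := η / η ^ 2), cfc_poisson_eq_smul ha hη]
  · have hz : ((t : ℂ) + η * I).im = η := by simp
    rw [φ.im_cauchy_eq ha (by rwa [hz]), hz, neg_neg, map_smul, smul_eq_mul,
      Complex.re_ofReal_mul]
  · intro x
    rw [abs_of_nonneg (by positivity)]
    gcongr
    nlinarith [sq_nonneg (t - x)]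

end Distribution

/-! ### The Cauchy transform of the arcsine law. -/

section Arcsine

/-- Inversion of the Joukowski map on the upper half plane. -/
theorem exists_joukowski {z : ℂ} (hz : 0 < z.im) :
    ∃ q : ℂ, q ≠ 0 ∧ ‖q‖ < 1 ∧ q + q⁻¹ = Real.sqrt 2 * z := by
  have key : ∃ q : ℂ, q ≠ 0 ∧ q + q⁻¹ = Real.sqrt 2 * z := by
    obtain ⟨s, hs⟩ := IsAlgClosed.exists_pow_nat_eq ((Real.sqrt 2 * z) ^ 2 - 4) two_pos
    have h4 : (Real.sqrt 2 * z + s) * (Real.sqrt 2 * z - s) = 4 := by linear_combination -hs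
    have h0 : Real.sqrt 2 * z + s ≠ 0 := by
      intro h; rw [h, zero_mul] at h4; norm_num at h4
    refine ⟨(Real.sqrt 2 * z + s) / 2, div_ne_zero h0 two_ne_zero, ?_⟩
    field_simp
    linear_combination -h4
  obtain ⟨q, hq0, hq⟩ := key
  have hs2 : 0 < Real.sqrt 2 := by positivity
  rcases lt_trichotomy ‖q‖ 1 with h | h | h
  · exact ⟨q, hq0, h, hq⟩
  -- On the unit circle `q + q⁻¹ = q + q̄` is real, whereas `√2 z` is not.
  · exfalso
    rw [Complex.inv_eq_conj h] at hq
    have := congrArg Complex.im hq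
    rw [Complex.add_im, Complex.conj_im, Complex.im_ofReal_mul, add_neg_cancel] at this
    exact (mul_pos hs2 hz).ne this
  · exact ⟨q⁻¹, inv_ne_zero hq0, by rw [norm_inv]; exact inv_lt_one_of_one_lt₀ h,
      by rw [inv_inv, add_comm, hq]⟩

theorem one_sub_mul_circleMap_ne_zero {q : ℂ} (hq : ‖q‖ < 1) (θ : ℝ) :
    1 - q * circleMap 0 1 θ ≠ 0 := by
  intro h
  have : ‖q * circleMap 0 1 θ‖ = 1 := by rw [← sub_eq_zero.1 h, norm_one]
  rw [norm_mul, norm_circleMap_zero, abs_one, mul_one] at this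
  exact hq.ne this

/-- Mean value property: the integrand is holomorphic on the closed disc and equals `1` at its
centre. -/
theorem integral_inv_one_sub_mul_circleMap {q : ℂ} (hq : ‖q‖ < 1) :
    ∫ θ in (0 : ℝ)..2 * Real.pi, (1 - q * circleMap 0 1 θ)⁻¹ = 2 * Real.pi := by
  have hne : ∀ w ∈ Metric.closedBall (0 : ℂ) 1, 1 - q * w ≠ 0 := by
    intro w hw h
    have : ‖q * w‖ = 1 := by rw [← sub_eq_zero.1 h, norm_one]
    rw [norm_mul] at this
    have hw' : ‖w‖ ≤ 1 := by simpa using hw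
    nlinarith [norm_nonneg q, norm_nonneg w]
  have hd : DifferentiableOn ℂ (fun w => (1 - q * w)⁻¹) (Metric.closedBall 0 1) :=
    DifferentiableOn.inv (by fun_prop) hne
  have h := DiffContOnCl.circleAverage (f := fun w : ℂ => (1 - q * w)⁻¹) (c := 0) (R := 1) (by
    rw [abs_one]
    exact DifferentiableOn.diffContOnCl (by rwa [closure_ball _ one_ne_zero]))
  rw [Real.circleAverage_def, mul_zero, sub_zero, inv_one, Complex.real_smul] at h
  have hpi : (2 * Real.pi : ℂ) ≠ 0 := by exact_mod_cast Real.two_pi_pos.ne'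
  push_cast at h
  rwa [inv_mul_eq_one₀ hpi, eq_comm] at h

/-- The integral of the (complexified) Poisson kernel. -/
theorem integral_inv_sub_cos {q : ℂ} (hq0 : q ≠ 0) (hq : ‖q‖ < 1) :
    ∫ θ in (0 : ℝ)..Real.pi, (q + q⁻¹ - 2 * Real.cos θ)⁻¹ = Real.pi * (q⁻¹ - q)⁻¹ := by
  set h : ℝ → ℂ := fun θ => (1 - q * circleMap 0 1 θ)⁻¹ with hh
  have hcont : Continuous h :=
    Continuous.inv₀ (by fun_prop) (one_sub_mul_circleMap_ne_zero hq)
  have hper : ∀ θ : ℝ, circleMap 0 1 (2 * Real.pi - θ) = circleMap 0 1 (-θ) := fun θ => by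
    have := periodic_circleMap 0 1 (-θ)
    rw [← this]; congr 1; ring
  have hprod : ∀ θ : ℝ, circleMap 0 1 θ * circleMap 0 1 (-θ) = 1 := fun θ => by
    simp [circleMap, ← Complex.exp_add]
  have hsum : ∀ θ : ℝ, circleMap 0 1 θ + circleMap 0 1 (-θ) = 2 * Real.cos θ := fun θ => by
    rw [Complex.ofReal_cos, Complex.two_cos]
    simp [circleMap]
  have hq1 : 1 - q ^ 2 ≠ 0 := by
    intro h0
    have : ‖q ^ 2‖ = 1 := by rw [← sub_eq_zero.1 h0, norm_one]
    rw [norm_pow] at this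
    nlinarith [norm_nonneg q]
  have hqq : q⁻¹ - q ≠ 0 := by
    intro h0
    apply hq1
    have : q * (q⁻¹ - q) = 0 := by rw [h0, mul_zero]
    rw [mul_sub, mul_inv_cancel₀ hq0] at this
    rw [sq]; exact this
  -- Partial fractions in `e^(iθ)`. Writing the conjugate term as a reflection `2π - θ` lets the two
  -- half-circle integrals join into a full circle, giving `2π - π = π`.
  have hkey : ∀ θ : ℝ, (q + q⁻¹ - 2 * Real.cos θ)⁻¹ =
      (q⁻¹ - q)⁻¹ * (h θ + h (2 * Real.pi - θ) - 1) := fun θ => by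
    have n1 := one_sub_mul_circleMap_ne_zero hq θ
    have n2 := one_sub_mul_circleMap_ne_zero hq (-θ)
    simp only [hh]
    rw [hper, ← hsum]
    have hp := hprod θ
    set u := circleMap 0 1 θ
    set v := circleMap 0 1 (-θ)
    have e1 : q + q⁻¹ - (u + v) = q⁻¹ * ((1 - q * u) * (1 - q * v)) := by
      field_simp
      linear_combination (-q ^ 2) * hp
    have e2 : (1 - q * u)⁻¹ + (1 - q * v)⁻¹ - 1 =
        (1 - q ^ 2) * ((1 - q * u) * (1 - q * v))⁻¹ := by
      field_simp
      linear_combination (-q ^ 2) * hp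
    have e3 : q⁻¹ - q = q⁻¹ * (1 - q ^ 2) := by field_simp
    rw [e1, e2, e3, mul_inv, mul_inv q⁻¹]
    field_simp
  simp_rw [hkey]
  have i1 : ∀ u v : ℝ, IntervalIntegrable h volume u v := hcont.intervalIntegrable
  have i2 : IntervalIntegrable (fun θ => h (2 * Real.pi - θ)) volume 0 Real.pi :=
    (hcont.comp (continuous_const.sub continuous_id)).intervalIntegrable _ _
  rw [intervalIntegral.integral_const_mul,
    intervalIntegral.integral_sub (f := fun θ => h θ + h (2 * Real.pi - θ)) ((i1 _ _).add i2)
      intervalIntegrable_const,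
    intervalIntegral.integral_add (i1 _ _) i2,
    intervalIntegral.integral_comp_sub_left h, sub_zero,
    show 2 * Real.pi - Real.pi = Real.pi by ring,
    intervalIntegral.integral_add_adjacent_intervals (i1 _ _) (i1 _ _), hh,
    integral_inv_one_sub_mul_circleMap hq,
    intervalIntegral.integral_const]
  simp
  ring

theorem image_cos_Ioo :
    (fun θ => Real.sqrt 2 * Real.cos θ) '' Set.Ioo 0 Real.pi =
      Set.Ioo (-Real.sqrt 2) (Real.sqrt 2) := by
  have hs2 : 0 < Real.sqrt 2 := by positivity
  ext t
  constructor
  · rintro ⟨θ, hθ, rfl⟩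
    have h1 : Real.cos θ < 1 := by
      rw [← Real.cos_zero]
      exact Real.cos_lt_cos_of_nonneg_of_le_pi le_rfl hθ.2.le hθ.1
    have h2 : -1 < Real.cos θ := by
      rw [← Real.cos_pi]
      exact Real.cos_lt_cos_of_nonneg_of_le_pi hθ.1.le le_rfl hθ.2
    constructor <;> simp only <;> nlinarith
  · rintro ⟨h1, h2⟩
    have h3 : -1 < t / Real.sqrt 2 := by rw [lt_div_iff₀ hs2]; linarith
    have h4 : t / Real.sqrt 2 < 1 := by rw [div_lt_iff₀ hs2]; linarith
    refine ⟨Real.arccos (t / Real.sqrt 2), ⟨Real.arccos_pos.2 h4, ?_⟩, ?_⟩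
    · refine lt_of_le_of_ne (Real.arccos_le_pi _) fun h => ?_
      rw [Real.arccos_eq_pi] at h
      linarith
    · change Real.sqrt 2 * Real.cos (Real.arccos _) = t
      rw [Real.cos_arccos h3.le h4.le, mul_div_cancel₀ _ hs2.ne']

/-- Under `t = √2 cos θ` the arcsine law becomes the uniform law on `(0, π)`. -/
theorem integral_arcsineLaw (f : ℝ → ℂ) :
    ∫ t, f t ∂arcsineLaw =
      (Real.pi : ℂ)⁻¹ * ∫ θ in (0 : ℝ)..Real.pi, f (Real.sqrt 2 * Real.cos θ) := by
  have hs2 : 0 < Real.sqrt 2 := by positivity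
  rw [arcsineLaw, integral_withDensity_eq_integral_toReal_smul (by fun_prop)
    (Filter.Eventually.of_forall fun _ => ENNReal.ofReal_lt_top), ← image_cos_Ioo,
    integral_image_eq_integral_abs_deriv_smul measurableSet_Ioo
      (f' := fun θ => Real.sqrt 2 * (-Real.sin θ))
      (fun θ _ => ((Real.hasDerivAt_cos θ).const_mul _).hasDerivWithinAt)
      (fun θ hθ θ' hθ' h => Real.injOn_cos (Set.Ioo_subset_Icc_self hθ)
        (Set.Ioo_subset_Icc_self hθ') (mul_left_cancel₀ hs2.ne' h)),
    intervalIntegral.integral_of_le Real.pi_pos.le, integral_Ioc_eq_integral_Ioo,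
    ← integral_const_mul]
  refine setIntegral_congr_fun measurableSet_Ioo fun θ hθ => ?_
  have hsin : 0 < Real.sin θ := Real.sin_pos_of_mem_Ioo hθ
  have e1 : (2 : ℝ) - (Real.sqrt 2 * Real.cos θ) ^ 2 = (Real.sqrt 2 * Real.sin θ) ^ 2 := by
    rw [mul_pow, mul_pow, Real.sq_sqrt zero_le_two]
    linarith [Real.sin_sq_add_cos_sq θ]
  rw [e1, Real.sqrt_sq (by positivity), ENNReal.toReal_ofReal (by positivity), smul_smul, mul_neg,
    abs_neg, abs_of_pos (by positivity), Complex.real_smul]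
  congr 1
  push_cast
  have : (Real.sin θ : ℂ) ≠ 0 := by exact_mod_cast hsin.ne'
  have h2 : (Real.sqrt 2 : ℂ) ≠ 0 := by exact_mod_cast hs2.ne'
  have h3 : (Real.pi : ℂ) ≠ 0 := by exact_mod_cast Real.pi_ne_zero
  rw [← Complex.ofReal_sin]
  field_simp

/-- The reciprocal Cauchy transform of the standard arcsine law is the branch of `√(z² - 2)` on the
upper half plane. -/
theorem exists_recipCauchy_arcsineLaw {z : ℂ} (hz : 0 < z.im) :
    ∃ F : ℂ, F ^ 2 = z ^ 2 - 2 ∧ z.im ≤ F.im ∧ ∫ t : ℝ, (z - t)⁻¹ ∂arcsineLaw = F⁻¹ := by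
  obtain ⟨q, hq0, hq, hqz⟩ := exists_joukowski hz
  have hs2 : 0 < Real.sqrt 2 := by positivity
  have hs : (Real.sqrt 2 : ℂ) ^ 2 = 2 := by
    rw [← Complex.ofReal_pow, Real.sq_sqrt zero_le_two]; norm_num
  have hs0 : (Real.sqrt 2 : ℂ) ≠ 0 := by exact_mod_cast hs2.ne'
  refine ⟨(q⁻¹ - q) / Real.sqrt 2, ?_, ?_, ?_⟩
  · rw [div_pow, hs]
    have e1 : (q⁻¹ - q) ^ 2 = (q + q⁻¹) ^ 2 - 4 * (q * q⁻¹) := by ring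
    rw [e1, hqz, mul_inv_cancel₀ hq0, mul_pow, hs]
    ring
  · have hzq : z.im * Real.sqrt 2 = q.im + q⁻¹.im := by
      have := congrArg Complex.im hqz
      rw [Complex.im_ofReal_mul, Complex.add_im] at this
      linarith
    have hN : 0 < Complex.normSq q := Complex.normSq_pos.2 hq0
    have hN1 : Complex.normSq q < 1 := by
      rw [Complex.normSq_eq_norm_sq]; nlinarith [norm_nonneg q]
    have hinv : q⁻¹.im * Complex.normSq q = - q.im := by
      rw [Complex.inv_im, div_mul_cancel₀ _ hN.ne']
    -- As `Im (q + q⁻¹) = Im q · (1 - |q|⁻²)` is positive and `|q| < 1`, `Im q` is negative;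
    -- replacing `q` by `-q` then only raises the imaginary part.
    have him : q.im < 0 := by
      by_contra! h
      have : 0 < (z.im * Real.sqrt 2) * Complex.normSq q := by positivity
      rw [hzq, add_mul, hinv] at this
      nlinarith
    rw [Complex.div_ofReal_im, le_div_iff₀ hs2, hzq, Complex.sub_im]
    linarith
  · rw [integral_arcsineLaw]
    have : ∀ θ : ℝ, (z - ((Real.sqrt 2 * Real.cos θ : ℝ) : ℂ))⁻¹ =
        Real.sqrt 2 * (q + q⁻¹ - 2 * Real.cos θ)⁻¹ := fun θ => by
      have : q + q⁻¹ - 2 * Real.cos θ = Real.sqrt 2 * (z - ((Real.sqrt 2 * Real.cos θ : ℝ) : ℂ)) := by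
        rw [hqz]; push_cast; linear_combination (Complex.cos θ) * hs
      rw [this, mul_inv, mul_inv_cancel_left₀ hs0]
    simp_rw [this]
    rw [intervalIntegral.integral_const_mul, integral_inv_sub_cos hq0 hq]
    have h3 : (Real.pi : ℂ) ≠ 0 := by exact_mod_cast Real.pi_ne_zero
    rw [inv_div]
    field_simp

end Arcsine

/-! ### From Cauchy transforms near the real line to the Lévy distance. -/

section Levy

theorem levyDist_le_of_mem {μ ν : Measure ℝ} {ε : ℝ} (hε : 0 < ε)
    (h : ∀ t : ℝ, μ.real (Set.Iic (t - ε)) - ε ≤ ν.real (Set.Iic t) ∧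
      ν.real (Set.Iic t) ≤ μ.real (Set.Iic (t + ε)) + ε) : levyDist μ ν ≤ ε :=
  csInf_le ⟨0, fun _ hx => hx.1.le⟩ ⟨hε, h⟩

theorem levyDist_le_one (μ ν : Measure ℝ) [IsProbabilityMeasure μ] [IsProbabilityMeasure ν] :
    levyDist μ ν ≤ 1 :=
  levyDist_le_of_mem one_pos fun _ =>
    ⟨(sub_nonpos.2 measureReal_le_one).trans measureReal_nonneg,
      measureReal_le_one.trans (le_add_of_nonneg_left measureReal_nonneg)⟩

/-- A bound for the Lévy distance to a compactly supported measure from a one-sided comparison of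
intervals. -/
theorem levyDist_le_of_Icc {μ ν : Measure ℝ} [IsProbabilityMeasure μ] [IsProbabilityMeasure ν]
    {s ε D ε' : ℝ} (hν : ν (Set.Icc (-s) s)ᶜ = 0) (hε : 0 < ε) (hD : 0 ≤ D)
    (h : ∀ a b, -s ≤ a → a ≤ b → b ≤ s →
      ν.real (Set.Icc a b) ≤ μ.real (Set.Icc (a - 2 * ε) (b + 2 * ε)) + D)
    (h3 : 3 * ε ≤ ε') (hD' : D ≤ ε') : levyDist μ ν ≤ ε' := by
  have hrestrict : ∀ U : Set ℝ, ν.real U ≤ ν.real (U ∩ Set.Icc (-s) s) := fun U => by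
    calc ν.real U ≤ ν.real (U ∩ Set.Icc (-s) s ∪ (Set.Icc (-s) s)ᶜ) :=
          measureReal_mono fun x hx => by
            by_cases hx' : x ∈ Set.Icc (-s) s
            exacts [Or.inl ⟨hx, hx'⟩, Or.inr hx']
      _ ≤ ν.real (U ∩ Set.Icc (-s) s) + ν.real (Set.Icc (-s) s)ᶜ := measureReal_union_le _ _
      _ = _ := by rw [measureReal_def ν (Set.Icc (-s) s)ᶜ, hν]; simp
  have hcmp : ∀ (U V : Set ℝ) (a b : ℝ), -s ≤ a → b ≤ s → U ∩ Set.Icc (-s) s ⊆ Set.Icc a b →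
      Set.Icc (a - 2 * ε) (b + 2 * ε) ⊆ V → ν.real U ≤ μ.real V + ε' := by
    intro U V a b ha hb hU hV
    refine (hrestrict U).trans ((measureReal_mono hU).trans ?_)
    rcases le_or_gt a b with hab | hab
    · exact (h a b ha hab hb).trans (add_le_add (measureReal_mono hV) hD')
    · rw [Set.Icc_eq_empty (not_le.2 hab), measureReal_empty]
      exact add_nonneg measureReal_nonneg (hD.trans hD')
  refine levyDist_le_of_mem (by linarith) fun t => ⟨?_, ?_⟩
  -- The lower bound on the distribution function comes from comparing right tails and taking
  -- complements.
  · have h1 := hcmp (Set.Ioi t) (Set.Ioi (t - ε')) (max t (-s)) s (le_max_right _ _) le_rfl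
      (fun x hx => ⟨max_le (le_of_lt hx.1) hx.2.1, hx.2.2⟩) (fun x hx => by
        have := hx.1; have := le_max_left t (-s); change t - ε' < x; linarith)
    rw [← Set.compl_Iic, ← Set.compl_Iic, probReal_compl_eq_one_sub measurableSet_Iic,
      probReal_compl_eq_one_sub measurableSet_Iic] at h1
    linarith
  · exact hcmp (Set.Iic t) (Set.Iic (t + ε')) (-s) (min t s) le_rfl (min_le_right _ _)
      (fun x hx => ⟨hx.2.1, le_min hx.1 hx.2.2⟩) (fun x hx => by
        have := hx.2; have := min_le_left t s; change x ≤ t + ε'; linarith)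

theorem integral_poisson_interval {η : ℝ} (hη : 0 < η) (a b x : ℝ) :
    ∫ t in a..b, η / ((t - x) ^ 2 + η ^ 2) =
      Real.arctan ((b - x) / η) - Real.arctan ((a - x) / η) := by
  refine intervalIntegral.integral_eq_sub_of_hasDerivAt
    (f := fun t => Real.arctan ((t - x) / η)) (fun t _ => ?_)
    (Continuous.intervalIntegrable (continuous_const.div (by fun_prop) fun t => by positivity) _ _)
  have h : HasDerivAt (fun t => Real.arctan ((t - x) / η))
      (1 / (1 + ((t - x) / η) ^ 2) * (1 / η)) t :=
    (((hasDerivAt_id t).sub_const x).div_const η).arctan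
  refine h.congr_deriv ?_
  have := hη.ne'
  field_simp
  ring

theorem integral_integral_poisson (μ : Measure ℝ) [IsFiniteMeasure μ] {η : ℝ} (hη : 0 < η)
    {a b : ℝ} (hab : a ≤ b) :
    ∫ t in a..b, ∫ x, η / ((t - x) ^ 2 + η ^ 2) ∂μ =
      ∫ x, (Real.arctan ((b - x) / η) - Real.arctan ((a - x) / η)) ∂μ := by
  rw [intervalIntegral.integral_of_le hab, integral_integral_swap]
  · refine integral_congr_ae (Filter.Eventually.of_forall fun x => ?_)
    change ∫ t in Set.Ioc a b, η / ((t - x) ^ 2 + η ^ 2) = _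
    rw [← intervalIntegral.integral_of_le hab, integral_poisson_interval hη]
  · refine Integrable.of_bound (C := η / η ^ 2) (Continuous.aestronglyMeasurable
      (continuous_const.div (by fun_prop) fun p => by positivity))
      (Filter.Eventually.of_forall fun p => ?_)
    rw [Function.uncurry, Real.norm_of_nonneg (by positivity)]
    gcongr
    nlinarith [sq_nonneg (p.1 - p.2)]

theorem pi_div_two_sub_arctan_le {u : ℝ} (hu : 0 < u) : Real.pi / 2 - Real.arctan u ≤ u⁻¹ := by
  rw [← Real.arctan_inv_of_pos hu]
  have h := Real.lt_tan (Real.arctan_pos.2 (inv_pos.2 hu)) (Real.arctan_lt_pi_div_two _)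
  rw [Real.tan_arctan] at h
  exact h.le

/-- Intervals are compared through the Poisson integrals of two measures. -/
theorem measureReal_Icc_le_of_poisson {μ ν : Measure ℝ} [IsProbabilityMeasure μ]
    [IsProbabilityMeasure ν] {η ε D a b : ℝ} (hη : 0 < η) (hε : 0 < ε) (hD : 0 ≤ D)
    (hab : a ≤ b)
    (h : ∫ t in (a - ε)..(b + ε), ∫ x, η / ((t - x) ^ 2 + η ^ 2) ∂ν ≤
      (∫ t in (a - ε)..(b + ε), ∫ x, η / ((t - x) ^ 2 + η ^ 2) ∂μ) + D) :
    ν.real (Set.Icc a b) ≤ μ.real (Set.Icc (a - 2 * ε) (b + 2 * ε)) + (η / ε + D) := by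
  rw [integral_integral_poisson _ hη (by linarith), integral_integral_poisson _ hη (by linarith)]
    at h
  -- `k` is a smoothed indicator times `π`: at least `π - 2η/ε` on `[a, b]` and at most `η/ε`
  -- outside `[a - 2ε, b + 2ε]`.
  set k : ℝ → ℝ := fun x => Real.arctan ((b + ε - x) / η) - Real.arctan ((a - ε - x) / η) with hk
  have htail : Real.pi / 2 - Real.arctan (ε / η) ≤ η / ε := by
    have := pi_div_two_sub_arctan_le (div_pos hε hη)
    rwa [inv_div] at this
  have hkc : Continuous k := by
    rw [hk]
    exact (Real.continuous_arctan.comp (by fun_prop)).sub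
      (Real.continuous_arctan.comp (by fun_prop))
  have hk0 : ∀ x, 0 ≤ k x := fun x => sub_nonneg.2 <| Real.arctan_strictMono.monotone <|
    (div_le_div_iff_of_pos_right hη).2 (by linarith)
  have hkpi : ∀ x, k x ≤ Real.pi := fun x => by
    have h1 := Real.arctan_lt_pi_div_two ((b + ε - x) / η)
    have h2 := Real.neg_pi_div_two_lt_arctan ((a - ε - x) / η)
    simp only [hk]; linarith
  have hki : ∀ ρ : Measure ℝ, IsFiniteMeasure ρ → Integrable k ρ := fun ρ _ =>
    Integrable.of_bound (C := Real.pi) hkc.aestronglyMeasurable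
      (Filter.Eventually.of_forall fun x => by
        rw [Real.norm_of_nonneg (hk0 x)]; exact hkpi x)
  have hind : ∀ (ρ : Measure ℝ) (_ : IsFiniteMeasure ρ) (c : ℝ) (u v : ℝ),
      Integrable ((Set.Icc u v).indicator fun _ => c) ρ := fun ρ _ c u v =>
    (integrable_const c).indicator measurableSet_Icc
  have hlow : (Real.pi - 2 * (η / ε)) * ν.real (Set.Icc a b) ≤ ∫ x, k x ∂ν := by
    have e : ∫ x, (Set.Icc a b).indicator (fun _ => Real.pi - 2 * (η / ε)) x ∂ν =
        (Real.pi - 2 * (η / ε)) * ν.real (Set.Icc a b) := by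
      rw [integral_indicator_const _ measurableSet_Icc, smul_eq_mul, mul_comm]
    rw [← e]
    refine integral_mono (hind _ inferInstance _ _ _) (hki _ inferInstance) fun x => ?_
    by_cases hx : x ∈ Set.Icc a b
    · rw [Set.indicator_of_mem hx]
      have h1 : Real.arctan (ε / η) ≤ Real.arctan ((b + ε - x) / η) :=
        Real.arctan_strictMono.monotone <| (div_le_div_iff_of_pos_right hη).2 (by linarith [hx.2])
      have h2 : Real.arctan ((a - ε - x) / η) ≤ Real.arctan (-(ε / η)) :=
        Real.arctan_strictMono.monotone <| by
          rw [← neg_div]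
          exact (div_le_div_iff_of_pos_right hη).2 (by linarith [hx.1])
      rw [Real.arctan_neg] at h2
      simp only [hk]; linarith
    · rw [Set.indicator_of_notMem hx]; exact hk0 x
  have hupp : ∫ x, k x ∂μ ≤ Real.pi * μ.real (Set.Icc (a - 2 * ε) (b + 2 * ε)) + η / ε := by
    have e : ∫ x, ((Set.Icc (a - 2 * ε) (b + 2 * ε)).indicator (fun _ => Real.pi) x + η / ε) ∂μ =
        Real.pi * μ.real (Set.Icc (a - 2 * ε) (b + 2 * ε)) + η / ε := by
      rw [integral_add (hind _ inferInstance _ _ _) (integrable_const _),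
        integral_indicator_const _ measurableSet_Icc, integral_const, probReal_univ, smul_eq_mul,
        one_smul, mul_comm]
    rw [← e]
    refine integral_mono (hki _ inferInstance)
      ((hind _ inferInstance _ _ _).add (integrable_const _)) fun x => ?_
    by_cases hx : x ∈ Set.Icc (a - 2 * ε) (b + 2 * ε)
    · change k x ≤ (Set.Icc (a - 2 * ε) (b + 2 * ε)).indicator (fun _ => Real.pi) x + η / ε
      rw [Set.indicator_of_mem hx]
      exact (hkpi x).trans (le_add_of_nonneg_right (by positivity))
    · change k x ≤ (Set.Icc (a - 2 * ε) (b + 2 * ε)).indicator (fun _ => Real.pi) x + η / ε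
      rw [Set.indicator_of_notMem hx, zero_add]
      refine le_trans ?_ htail
      rw [Set.mem_Icc, not_and_or, not_le, not_le] at hx
      rcases hx with hx | hx
      · have h1 : Real.arctan (ε / η) ≤ Real.arctan ((a - ε - x) / η) :=
          Real.arctan_strictMono.monotone <| (div_le_div_iff_of_pos_right hη).2 (by linarith)
        have h2 := Real.arctan_lt_pi_div_two ((b + ε - x) / η)
        simp only [hk]; linarith
      · have h1 : Real.arctan ((b + ε - x) / η) ≤ Real.arctan (-(ε / η)) :=
          Real.arctan_strictMono.monotone <| by
            rw [← neg_div]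
            exact (div_le_div_iff_of_pos_right hη).2 (by linarith)
        have h2 := Real.neg_pi_div_two_lt_arctan ((a - ε - x) / η)
        rw [Real.arctan_neg] at h1
        simp only [hk]; linarith
  have hr : 0 ≤ η / ε := by positivity
  have hν1 : ν.real (Set.Icc a b) ≤ 1 := measureReal_le_one
  have hpi := Real.pi_gt_three
  -- The losses `2η/ε` and `η/ε` add to `3η/ε`, absorbed after division by `π` because `π > 3`.
  have : Real.pi * ν.real (Set.Icc a b) ≤
      Real.pi * (μ.real (Set.Icc (a - 2 * ε) (b + 2 * ε)) + (η / ε + D)) := by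
    nlinarith [mul_le_mul_of_nonneg_left hν1 hr, mul_nonneg (sub_nonneg.2 hpi.le) hr,
      mul_nonneg (sub_nonneg.2 hpi.le) hD]
  exact le_of_mul_le_mul_left this Real.pi_pos

theorem intervalIntegrable_abs_sub_rpow (c u v : ℝ) :
    IntervalIntegrable (fun t => |t - c| ^ (-(1 / 2) : ℝ)) volume u v := by
  have h : IntervalIntegrable (fun t : ℝ => |t| ^ (-(1 / 2) : ℝ)) volume (u - c) (v - c) := by
    have := (intervalIntegral.intervalIntegrable_cpow' (a := u - c) (b := v - c)
      (r := ((-(1 / 2) : ℝ) : ℂ)) (by rw [Complex.ofReal_re]; norm_num)).norm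
    refine this.congr fun t _ => ?_
    change ‖(t : ℂ) ^ _‖ = _
    rw [Complex.norm_cpow_real, Complex.norm_real, Real.norm_eq_abs]
  simpa using h.comp_sub_right c

/-- An integrable majorant of the Cauchy transform of the arcsine law near the real line. -/
def arcsineMajorant (t : ℝ) : ℝ :=
  |t - Real.sqrt 2| ^ (-(1 / 2) : ℝ) + |t - -Real.sqrt 2| ^ (-(1 / 2) : ℝ)

theorem arcsineMajorant_nonneg (t : ℝ) : 0 ≤ arcsineMajorant t := by
  unfold arcsineMajorant; positivity

theorem intervalIntegrable_arcsineMajorant (u v : ℝ) :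
    IntervalIntegrable arcsineMajorant volume u v :=
  (intervalIntegrable_abs_sub_rpow _ u v).add (intervalIntegrable_abs_sub_rpow _ u v)

/-- Uniformly in `η`, `|F|² ≥ |t² - 2| = |t - √2| |t + √2|`, and at least one of these factors is `≥
1`. -/
theorem inv_norm_le_arcsineMajorant {t η : ℝ} {F : ℂ} (hF : F ^ 2 = (t + η * I) ^ 2 - 2)
    (h1 : t ≠ Real.sqrt 2) (h2 : t ≠ -Real.sqrt 2) : ‖F‖⁻¹ ≤ arcsineMajorant t := by
  have hs : Real.sqrt 2 ^ 2 = 2 := Real.sq_sqrt zero_le_two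
  set s := Real.sqrt 2 with hsdef
  have hs1 : 1 ≤ s := by rw [hsdef, Real.one_le_sqrt]; norm_num
  have hu : 0 < |t - s| := abs_pos.2 (sub_ne_zero.2 h1)
  have hv : 0 < |t - -s| := abs_pos.2 (sub_ne_zero.2 h2)
  have hprod : |t - s| * |t - -s| ≤ ‖F‖ ^ 2 := by
    rw [← norm_pow, hF, ← abs_mul]
    refine abs_le_of_sq_le_sq ?_ (norm_nonneg _)
    rw [← Complex.normSq_eq_norm_sq, Complex.normSq_apply]
    have e1 : (((t : ℂ) + η * I) ^ 2 - 2).re = t ^ 2 - η ^ 2 - 2 := by simp [sq]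
    have e2 : (((t : ℂ) + η * I) ^ 2 - 2).im = 2 * t * η := by simp [sq]; ring
    have e3 : (t - s) * (t - -s) = t ^ 2 - 2 := by rw [← hs]; ring
    rw [e1, e2, e3]
    nlinarith [sq_nonneg (η ^ 2), sq_nonneg (t * η), sq_nonneg η]
  have key : ∀ u : ℝ, 0 < u → u ≤ ‖F‖ ^ 2 → ‖F‖⁻¹ ≤ u ^ (-(1 / 2) : ℝ) := fun u hu h => by
    rw [Real.rpow_neg hu.le, ← Real.sqrt_eq_rpow]
    exact inv_anti₀ (Real.sqrt_pos.2 hu) (Real.sqrt_le_iff.2 ⟨norm_nonneg _, h⟩)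
  have hmax : 1 ≤ |t - s| ∨ 1 ≤ |t - -s| := by
    by_contra! h
    have h1 := (abs_lt.1 h.1).1
    have h2 := (abs_lt.1 h.2).2
    linarith
  rcases hmax with h | h
  · exact (key _ hv ((le_mul_of_one_le_left hv.le h).trans hprod)).trans
      (le_add_of_nonneg_left (by positivity))
  · exact (key _ hu ((le_mul_of_one_le_right hu.le h).trans hprod)).trans
      (le_add_of_nonneg_right (by positivity))

/-- Use `H⁻¹ - F⁻¹ = (F² - H²) / (H F (F + H))`. Both imaginary parts are at least `η`, so `F + H`
cannot cancel: this is where the choice of branch enters. The resulting factor is `√δ / η³`, and the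
power `7` makes it at most `√η`. -/
theorem norm_inv_sub_inv_le {F H : ℂ} {δ η : ℝ} (hη : 0 < η) (hF : η ≤ F.im) (hH : η ≤ H.im)
    (h : ‖H ^ 2 - F ^ 2‖ ≤ 2 * Real.sqrt δ / η) (hδ : δ ≤ η ^ 7) :
    ‖H⁻¹ - F⁻¹‖ ≤ Real.sqrt η * ‖F‖⁻¹ := by
  have hF0 : F ≠ 0 := by rintro rfl; simp at hF; linarith
  have hH0 : H ≠ 0 := by rintro rfl; simp at hH; linarith
  have hFH : 2 * η ≤ ‖F + H‖ := by
    refine le_trans ?_ ((le_abs_self _).trans (Complex.abs_im_le_norm _))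
    rw [Complex.add_im]; linarith
  have hHn : η ≤ ‖H‖ := hH.trans ((le_abs_self _).trans (Complex.abs_im_le_norm _))
  have hFH0 : F + H ≠ 0 := norm_pos_iff.1 (by linarith)
  have hsq : Real.sqrt δ ≤ η ^ 3 * Real.sqrt η := by
    refine (Real.sqrt_le_sqrt hδ).trans (le_of_eq ?_)
    rw [show η ^ 7 = (η ^ 3) ^ 2 * η by ring, Real.sqrt_mul (by positivity),
      Real.sqrt_sq (by positivity)]
  have e : H⁻¹ - F⁻¹ = -((H ^ 2 - F ^ 2) * F⁻¹ / (H * (F + H))) := by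
    field_simp
    ring
  rw [e, norm_neg, norm_div, norm_mul, norm_mul, norm_inv]
  have hden : 0 < ‖H‖ * ‖F + H‖ := by positivity
  rw [div_le_iff₀ hden]
  have h3 : ‖H ^ 2 - F ^ 2‖ ≤ Real.sqrt η * (‖H‖ * ‖F + H‖) := by
    calc _ ≤ 2 * Real.sqrt δ / η := h
      _ ≤ 2 * (η ^ 3 * Real.sqrt η) / η := by gcongr
      _ = Real.sqrt η * (η * (2 * η)) := by field_simp
      _ ≤ _ := by gcongr
  calc _ ≤ Real.sqrt η * (‖H‖ * ‖F + H‖) * ‖F‖⁻¹ := by gcongr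
    _ = _ := by ring

theorem arcsineLaw_compl_Icc :
    arcsineLaw (Set.Icc (-Real.sqrt 2) (Real.sqrt 2))ᶜ = 0 := by
  refine withDensity_absolutelyContinuous _ _ ?_
  rw [Measure.restrict_apply measurableSet_Icc.compl]
  convert measure_empty (μ := volume)
  refine Set.eq_empty_of_forall_notMem fun x hx => hx.1 (Set.Ioo_subset_Icc_self hx.2)

theorem integral_poisson_eq_im (μ : Measure ℝ) [IsFiniteMeasure μ] {η : ℝ} (hη : 0 < η) (t : ℝ) :
    ∫ x, η / ((t - x) ^ 2 + η ^ 2) ∂μ = -(∫ x : ℝ, ((t : ℂ) + η * I - x)⁻¹ ∂μ).im := by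
  have him : ∀ x : ℝ, ((t : ℂ) + η * I - x).im = η := fun x => by simp
  have hre : ∀ x : ℝ, ((t : ℂ) + η * I - x).re = t - x := fun x => by simp
  have hne : ∀ x : ℝ, (t : ℂ) + η * I - x ≠ 0 := fun x h => by
    have := him x
    rw [h, Complex.zero_im] at this
    exact hη.ne this
  have hint : Integrable (fun x : ℝ => ((t : ℂ) + η * I - x)⁻¹) μ := by
    refine Integrable.of_bound (C := η⁻¹)
      (Continuous.inv₀ (by fun_prop) hne).aestronglyMeasurable
      (Filter.Eventually.of_forall fun x => ?_)
    rw [norm_inv]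
    refine inv_anti₀ hη ?_
    have := Complex.abs_im_le_norm ((t : ℂ) + η * I - x)
    rwa [him, abs_of_pos hη] at this
  have h := integral_im (𝕜 := ℂ) hint
  change ∫ x : ℝ, (((t : ℂ) + η * I - x)⁻¹).im ∂μ = (∫ x : ℝ, ((t : ℂ) + η * I - x)⁻¹ ∂μ).im at h
  rw [← h, ← integral_neg]
  congr 1
  funext x
  rw [Complex.inv_im, him, Complex.normSq_apply, hre, him, neg_div, neg_neg, ← sq, ← sq]

end Levy

/-- A quantitative stability estimate: closeness of the squared reciprocal Cauchy transform to that
of the arcsine law bounds the Lévy distance. -/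
theorem CState.levyDist_arcsineLaw_le {A : Type*} [CStarAlgebra A] (φ : CState A) {Y : A}
    (hY : IsSelfAdjoint Y) [IsProbabilityMeasure arcsineLaw] {δ η : ℝ} (hη : 0 < η) (hη1 : η ≤ 1)
    (hδ : δ ≤ η ^ 7)
    (h : ∀ z : ℂ, 0 < z.im → z.im ≤ (φ.recipCauchy Y z).im ∧
      ‖φ.recipCauchy Y z ^ 2 - (z ^ 2 - 2)‖ ≤ 2 * Real.sqrt δ / z.im) :
    levyDist (φ.distribution Y) arcsineLaw ≤
      (3 + ∫ t in (-3 : ℝ)..3, arcsineMajorant t) * Real.sqrt η := by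
  have := φ.isProbabilityMeasure_distribution hY
  set C := ∫ t in (-3 : ℝ)..3, arcsineMajorant t with hC
  have hC0 : 0 ≤ C :=
    intervalIntegral.integral_nonneg (by norm_num) fun t _ => arcsineMajorant_nonneg t
  set ε := Real.sqrt η with hε
  have hε0 : 0 < ε := Real.sqrt_pos.2 hη
  have hε1 : ε ≤ 1 := Real.sqrt_le_one.2 hη1
  have hηε : η / ε = ε := by rw [hε, Real.div_sqrt]
  have hs2 : Real.sqrt 2 ≤ 2 := Real.sqrt_le_iff.2 (by norm_num)
  have hpt : ∀ t : ℝ, t ≠ Real.sqrt 2 → t ≠ -Real.sqrt 2 →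
      |(∫ x, η / ((t - x) ^ 2 + η ^ 2) ∂arcsineLaw) -
        ∫ x, η / ((t - x) ^ 2 + η ^ 2) ∂(φ.distribution Y)| ≤ ε * arcsineMajorant t := by
    intro t h1 h2
    have hz : ((t : ℂ) + η * I).im = η := by simp
    have hz0 : 0 < ((t : ℂ) + η * I).im := by rwa [hz]
    obtain ⟨F, hF2, hFim, hF⟩ := exists_recipCauchy_arcsineLaw hz0
    obtain ⟨g1, g2⟩ := h _ hz0
    rw [hz] at g1 g2 hFim
    rw [← hF2] at g2
    rw [integral_poisson_eq_im _ hη, hF, φ.integral_poisson_distribution hY hη]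
    have e : φ.cauchy Y (t + η * I) = (φ.recipCauchy Y (t + η * I))⁻¹ := by
      rw [CState.recipCauchy, inv_inv]
    rw [e, neg_sub_neg, ← Complex.sub_im]
    refine (Complex.abs_im_le_norm _).trans ((norm_inv_sub_inv_le hη hFim g1 g2 hδ).trans ?_)
    exact mul_le_mul_of_nonneg_left (inv_norm_le_arcsineMajorant hF2 h1 h2) hε0.le
  have hii : ∀ (ρ : Measure ℝ) (_ : IsFiniteMeasure ρ) (a b : ℝ),
      IntervalIntegrable (fun t => ∫ x, η / ((t - x) ^ 2 + η ^ 2) ∂ρ) volume a b := by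
    intro ρ _ a b
    refine Continuous.intervalIntegrable (continuous_of_dominated
      (F := fun t x => η / ((t - x) ^ 2 + η ^ 2)) (bound := fun _ => η / η ^ 2)
      (fun t => (Continuous.aestronglyMeasurable
        (continuous_const.div (by fun_prop) fun x => by positivity)))
      (fun t => Filter.Eventually.of_forall fun x => ?_) (integrable_const _)
      (Filter.Eventually.of_forall fun x =>
        continuous_const.div (by fun_prop) fun t => by positivity)) _ _
    change ‖η / ((t - x) ^ 2 + η ^ 2)‖ ≤ η / η ^ 2
    rw [Real.norm_of_nonneg (by positivity)]
    gcongr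
    nlinarith [sq_nonneg (t - x)]
  -- The first `ε` in `D` is the smoothing loss `η/ε`; `ε * C` is the integrated difference of the
  -- Poisson integrals.
  refine levyDist_le_of_Icc (s := Real.sqrt 2) (ε := ε) (D := ε + ε * C) arcsineLaw_compl_Icc hε0
    (by positivity) ?_ (by nlinarith [mul_nonneg hε0.le hC0]) (by nlinarith)
  intro a b ha hab hb
  suffices hD : ∫ t in (a - ε)..(b + ε), ∫ x, η / ((t - x) ^ 2 + η ^ 2) ∂arcsineLaw ≤
      (∫ t in (a - ε)..(b + ε), ∫ x, η / ((t - x) ^ 2 + η ^ 2) ∂(φ.distribution Y)) + ε * C by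
    have hIcc := measureReal_Icc_le_of_poisson hη hε0 (mul_nonneg hε0.le hC0) hab hD
    rwa [hηε] at hIcc
  rw [← sub_le_iff_le_add', ← intervalIntegral.integral_sub (hii _ inferInstance _ _)
    (hii _ inferInstance _ _)]
  have hle : a - ε ≤ b + ε := by linarith
  have hne : ∀ c : ℝ, ∀ᵐ t : ℝ, t ≠ c := fun c => by
    simp [ae_iff]
  refine (Real.le_norm_self _).trans ((intervalIntegral.norm_integral_le_of_norm_le hle
    (g := fun t => ε * arcsineMajorant t) ?_
    ((intervalIntegrable_arcsineMajorant _ _).const_mul ε)).trans ?_)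
  · filter_upwards [hne (Real.sqrt 2), hne (-Real.sqrt 2)] with t h1 h2 _
    exact hpt t h1 h2
  · rw [intervalIntegral.integral_const_mul]
    -- The interval lies in `[-3, 3]` since `√2 ≤ 2` and `ε ≤ 1`.
    exact mul_le_mul_of_nonneg_left (intervalIntegral.integral_mono_interval (by linarith) hle
      (by linarith) (Filter.Eventually.of_forall arcsineMajorant_nonneg)
      (intervalIntegrable_arcsineMajorant _ _)) hε0.le

end MonotoneProbability

end
theorem mainTheorem8 :
    ∃ K : ℝ, 0 < K ∧
      ∀ (𝒜 : Type u) [CStarAlgebra 𝒜] (φ : MonotoneProbability.CState 𝒜) (Y : 𝒜)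
        (𝒜' : Type w) [CStarAlgebra 𝒜'] (φ' : MonotoneProbability.CState 𝒜') (A : 𝒜'),
        IsSelfAdjoint Y →
        MonotoneProbability.IsMonotoneInfinitelyDivisible.{u, v} φ Y →
        φ Y = 0 → φ (Y ^ 2) = 1 →
        MonotoneProbability.IsStandardArcsine φ' A →
          3 / 2 ≤ (φ (Y ^ 4)).re ∧
          MonotoneProbability.levyDist (φ.distribution Y) (φ'.distribution A) ≤
            K * ((φ (Y ^ 4)).re - 3 / 2) ^ ((1 : ℝ) / 14) := by
  have hC0 : 0 ≤ ∫ t in (-3 : ℝ)..3, MonotoneProbability.arcsineMajorant t :=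
    intervalIntegral.integral_nonneg (by norm_num) fun t _ =>
      MonotoneProbability.arcsineMajorant_nonneg t
  refine ⟨3 + ∫ t in (-3 : ℝ)..3, MonotoneProbability.arcsineMajorant t, by linarith, ?_⟩
  intro 𝒜 _ φ Y 𝒜' _ φ' A hY hdiv h1 h2 hA
  obtain ⟨h4, hF⟩ := hdiv.recipCauchy_sq_sub hY h1 h2
  refine ⟨h4, ?_⟩
  have hνp := φ'.isProbabilityMeasure_distribution hA.1
  have hμp := φ.isProbabilityMeasure_distribution hY
  -- That the arcsine law has mass `1` is inherited from the element `A`.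
  rw [hA.2] at hνp ⊢
  set K := 3 + ∫ t in (-3 : ℝ)..3, MonotoneProbability.arcsineMajorant t with hK
  set δ := (φ (Y ^ 4)).re - 3 / 2 with hδ
  have hδ0 : 0 ≤ δ := sub_nonneg.2 h4
  have hK1 : 1 ≤ K := by linarith
  rcases le_or_gt 1 δ with hδ1 | hδ1
  · refine (MonotoneProbability.levyDist_le_one _ _).trans ?_
    exact one_le_mul_of_one_le_of_one_le hK1 (Real.one_le_rpow hδ1 (by norm_num))
  · set r := δ ^ ((1 : ℝ) / 7) with hr
    have hr0 : 0 ≤ r := Real.rpow_nonneg hδ0 _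
    have hr1 : r < 1 := Real.rpow_lt_one hδ0 hδ1 (by norm_num)
    have hr7 : r ^ 7 = δ := by
      rw [hr, ← Real.rpow_natCast, ← Real.rpow_mul hδ0]; norm_num
    have hr14 : δ ^ ((1 : ℝ) / 14) = Real.sqrt r := by
      rw [Real.sqrt_eq_rpow, hr, ← Real.rpow_mul hδ0]; norm_num
    rw [hr14]
    -- The height must be positive while `r = δ^(1/7)` may be `0`, so the bound is taken for `η > r`
    -- and passed to the limit `η ↓ r`.
    have hlim : Filter.Tendsto (fun η => K * Real.sqrt η) (nhdsWithin r (Set.Ioi r))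
        (nhds (K * Real.sqrt r)) :=
      ((Real.continuous_sqrt.tendsto r).const_mul K).mono_left nhdsWithin_le_nhds
    refine ge_of_tendsto hlim ?_
    filter_upwards [Ioo_mem_nhdsGT hr1] with η hη
    exact φ.levyDist_arcsineLaw_le hY (hr0.trans_lt hη.1) hη.2.le
      (hr7 ▸ pow_le_pow_left₀ hr0 hη.1.le 7) hF
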